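/- Let $p\ge 1$, $\theta_0=(\omega_0,\alpha_{01},\dots,\alpha_{0p})^T$ with $\omega_0>0$, $\alpha_{0j}\ge 0$ for $1\le j\le p$ and $\alpha_{0p}>0$. Let $(\varepsilon_t)_{t\in\mathbb Z}$ be i.i.d. real random variables with $E\varepsilon_t=0$, $E\varepsilon_t^2=1$, and let $(X_t)_{t\in\mathbb Z}$ be a strictly stationary and ergodic process such that, for every $t$, $\varepsilon_t$ is independent of $(X_s)_{s<t}$ and, almost surely, \[X_t=\sigma_t\varepsilon_t,\qquad \sigma_t^2=\omega_0+\sum_{j=1}^p\alpha_{0j}X_{t-j}^2 .\] Assume that $\varepsilon_t^2$ is not almost surely constant, that $E|\varepsilon_t|^8<\infty$, and that the spectral radius of $\Sigma_4=E(\mathcal A_t^{\otimes 4})$ is less than $1$. Here $\otimes$ is the Kronecker product and $\mathcal A_t$ is the $(p+1)\times(p+1)$ matrix with first row $(\alpha_{01}\varepsilon_t^2,\dots,\alpha_{0p}\varepsilon_t^2,0)$, last row $(\alpha_{01},\dots,\alpha_{0p},0)$, and, for $2\le i\le p$, $i$-th row having a $1$ in column $i-1$ and $0$ elsewhere. (The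 condition on $\Sigma_4$ holds in particular if the spectral norm of $\Sigma_4$ is less than $1$.) Put $Y_t=(1,X_t^2,\dots,X_{t-p+1}^2)^T$. For $n\ge1$ let $\mathbf Y_n$ be the $n\times(p+1)$ matrix with rows $Y_0^T,\dots,Y_{n-1}^T$, let $\mathbf X_n=(X_1^2,\dots,X_n^2)^T$, let $Q_n(\theta)=\sum_{t=1}^n(X_t^2-\theta^TY_{t-1})^2$, and let \[\hat\theta_n=(\mathbf Y_n^T\mathbf Y_n)^{-1}\mathbf Y_n^T\mathbf X_n\] be the conditional least-squares estimator (assigned the value $0$ when $\mathbf Y_n^T\mathbf Y_n$ is singular). Then: (a) the matrices $U=E(Y_{t-1}Y_{t-1}^T)$ and $R(\theta_0)=E(\sigma_t^4\,Y_{t-1}Y_{t-1}^T)$ have finite entries and are positive definite; (b) for every neighbourhood $\Theta$ of $\theta_0$ in $\mathbb R^{p+1}$, with probability tending to $1$ as $n\to\infty$, $\mathbf Y_n^T\mathbf Y_n$ is invertible, $\hat\theta_n\in\Theta$, and $\hat\theta_n$ is the unique minimizer of $Q_n$ over $\mathbb R^{p+1}$ (hence also over $\Theta$); (c) as $n\to\infty$,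 \[\sqrt n\,(\hat\theta_n-\theta_0)\ \xrightarrow{d}\ \mathcal N\bigl(0,\ \mathrm{Var}(\varepsilon_t^2)\,U^{-1}R(\theta_0)U^{-1}\bigr).\] -/

import Mathlib

open MeasureTheory ProbabilityTheory Filter Topology

namespace ARCH

noncomputable section

/-- The conditional variance `σ_t²(θ) = ω + ∑_{j=1}^p α_j x_{t-j}²` along a path `x`, where
`θ = (ω, α_1, …, α_p)`. -/
def sigmaSq {p : ℕ} (θ : EuclideanSpace ℝ (Fin (p + 1))) (x : ℤ → ℝ) (t : ℤ) : ℝ :=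
  θ 0 + ∑ j : Fin p, θ j.succ * x (t - ((j : ℕ) + 1 : ℤ)) ^ 2

/-- The time shift on real-valued paths. -/
def shift (x : ℤ → ℝ) : ℤ → ℝ := fun t => x (t + 1)

/-- `X` is a stationary ergodic ARCH(`p`) process, with innovations `ε` and parameter
`θ₀ = (ω₀, α₀₁, …, α₀ₚ)`, on the probability space `(Ω, μ)`. -/
structure IsARCH {Ω : Type*} [MeasurableSpace Ω] (μ : Measure Ω) {p : ℕ}
    (θ₀ : EuclideanSpace ℝ (Fin (p + 1))) (ε X : ℤ → Ω → ℝ) : Prop where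
  /-- the order is at least one -/
  one_le_order : 1 ≤ p
  /-- `ω₀ > 0` -/
  omega_pos : 0 < θ₀ 0
  /-- `α₀ⱼ ≥ 0` -/
  alpha_nonneg : ∀ j : Fin p, 0 ≤ θ₀ j.succ
  /-- `α₀ₚ > 0` -/
  alpha_last_pos : 0 < θ₀ (Fin.last p)
  measurable_innovation : ∀ t, Measurable (ε t)
  measurable_process : ∀ t, Measurable (X t)
  /-- the innovations are independent -/
  indep : iIndepFun ε μ
  /-- the innovations are identically distributed -/
  identDistrib : ∀ s t, IdentDistrib (ε s) (ε t) μ μ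
  mean_zero : ∀ t, ∫ w, ε t w ∂μ = 0
  second_moment : ∀ t, ∫ w, ε t w ^ 2 ∂μ = 1
  /-- `ε_t` is independent of the whole past `(X_s)_{s < t}` -/
  indep_past : ∀ t, IndepFun (ε t) (fun w (s : Set.Iio t) => X s w) μ
  /-- `X_t = σ_t(θ₀) ε_t` -/
  equation : ∀ t, ∀ᵐ w ∂μ, X t w = Real.sqrt (sigmaSq θ₀ (fun s => X s w) t) * ε t w
  /-- the law of the process is invariant and ergodic under the time shift -/
  stationary_ergodic : Ergodic shift (μ.map (fun w t => X t w))

/-- The row `(α_1, …, α_p, 0)`. -/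
def alphaRow {p : ℕ} (θ : EuclideanSpace ℝ (Fin (p + 1))) : Fin (p + 1) → ℝ :=
  Fin.snoc (α := fun _ => ℝ) (fun j : Fin p => θ j.succ) 0

/-- The random coefficient matrix, as a function of the value `e` of the innovation, of the
recursion `z_t = b_t + A_t z_{t-1}` for `z_t = (X_t², …, X_{t-p+1}², σ_t²)`: its first row is
`(α_1 e², …, α_p e², 0)`, its last row is `(α_1, …, α_p, 0)`, and the rows between are those of
`(I_{p-1} 0 0)`. -/
def coeffMatrix {p : ℕ} (θ : EuclideanSpace ℝ (Fin (p + 1))) (e : ℝ) :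
    Matrix (Fin (p + 1)) (Fin (p + 1)) ℝ :=
  Matrix.of fun i c =>
    if i = 0 then alphaRow θ c * e ^ 2
    else if i = Fin.last p then alphaRow θ c
    else if (c : ℕ) + 1 = (i : ℕ) then 1 else 0

/-- The `s`-fold tensor (Kronecker) power `A ⊗ ⋯ ⊗ A` of a square matrix, with multi-indices
as indices. -/
def tensorPower {m : ℕ} (s : ℕ) (A : Matrix (Fin m) (Fin m) ℝ) :
    Matrix (Fin s → Fin m) (Fin s → Fin m) ℝ :=
  Matrix.of fun r c => ∏ i, A (r i) (c i)

/-- `Σ_s = E (A_t ⊗ ⋯ ⊗ A_t)`, the expectation of a matrix being taken entrywise; `e` is the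
innovation at time `t`. -/
def SigmaMat {Ω : Type*} [MeasurableSpace Ω] (μ : Measure Ω) {p : ℕ} (s : ℕ)
    (θ : EuclideanSpace ℝ (Fin (p + 1))) (e : Ω → ℝ) :
    Matrix (Fin s → Fin (p + 1)) (Fin s → Fin (p + 1)) ℝ :=
  Matrix.of fun r c => ∫ w, tensorPower s (coeffMatrix θ (e w)) r c ∂μ

/-- The regressor `Y_t = (1, x_t², …, x_{t-p+1}²)`. -/
def regressor (p : ℕ) (x : ℤ → ℝ) (t : ℤ) : Fin (p + 1) → ℝ :=
  Fin.cons (α := fun _ => ℝ) 1 (fun j : Fin p => x (t - ((j : ℕ) : ℤ)) ^ 2)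

/-- The `n × (p+1)` design matrix whose `t`-th row is `Y_{t-1}`, `t = 1, …, n`. -/
def design (p n : ℕ) (x : ℤ → ℝ) : Matrix (Fin n) (Fin (p + 1)) ℝ :=
  Matrix.of fun i => regressor p x ((i : ℕ) : ℤ)

/-- The response vector `(x_1², …, x_n²)`. -/
def response (n : ℕ) (x : ℤ → ℝ) : Fin n → ℝ := fun i => x (((i : ℕ) : ℤ) + 1) ^ 2

/-- The criterion `Q_n(θ) = ∑_{t=1}^n (x_t² - θᵀ Y_{t-1})²`. -/
def criterion (p n : ℕ) (x : ℤ → ℝ) (θ : EuclideanSpace ℝ (Fin (p + 1))) : ℝ :=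
  ∑ i : Fin n, (response n x i - WithLp.ofLp θ ⬝ᵥ regressor p x ((i : ℕ) : ℤ)) ^ 2

/-- The conditional least-squares estimator `(YᵀY)⁻¹ Yᵀ X`. -/
def lsEstimator (p n : ℕ) (x : ℤ → ℝ) : EuclideanSpace ℝ (Fin (p + 1)) :=
  WithLp.toLp 2
    (Matrix.mulVec ((design p n x).transpose * design p n x)⁻¹
      (Matrix.mulVec (design p n x).transpose (response n x)))

/-- `U = E (Y_{t-1} Y_{t-1}ᵀ)`. -/
def matU {Ω : Type*} [MeasurableSpace Ω] (μ : Measure Ω) (p : ℕ) (X : ℤ → Ω → ℝ) (t : ℤ) :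
    Matrix (Fin (p + 1)) (Fin (p + 1)) ℝ :=
  Matrix.of fun i j =>
    ∫ w, regressor p (fun s => X s w) (t - 1) i * regressor p (fun s => X s w) (t - 1) j ∂μ

/-- `R(θ) = E (σ_t⁴(θ) Y_{t-1} Y_{t-1}ᵀ)`. -/
def matR {Ω : Type*} [MeasurableSpace Ω] (μ : Measure Ω) {p : ℕ}
    (θ : EuclideanSpace ℝ (Fin (p + 1))) (X : ℤ → Ω → ℝ) (t : ℤ) :
    Matrix (Fin (p + 1)) (Fin (p + 1)) ℝ :=
  Matrix.of fun i j =>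
    ∫ w, sigmaSq θ (fun s => X s w) t ^ 2 *
      (regressor p (fun s => X s w) (t - 1) i * regressor p (fun s => X s w) (t - 1) j) ∂μ

end

end ARCH

/-! Squared ARCH observations satisfy a linear regression: `X_t² = θ₀ᵀ Y_{t-1} + σ_t² (ε_t² - 1)`,
with noise that is centred given the past. Whenever the Gram matrix is invertible, the normal
equations give the exact identity `√n (θ̂_n - θ₀) = (n⁻¹ YᵀY)⁻¹ · score`, where the score is
`n^{-1/2} ∑ Y_{t-1} σ_t² (ε_t² - 1)` (`sqrt_smul_lsEstimator_sub`). Three facts then suffice.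

Moments. The vector `(X_t², …, X_{t-p+1}², σ_t²)` obeys an affine recursion with independent
matrices `A_t`. Fourth moments of the entries of `A_t ⋯ A_{t-n+1}` are diagonal entries of powers of
`Σ_4`, hence decay geometrically. The solution series is therefore bounded in `L⁴`, and so `X_t² ∈
L⁴` (`IsARCH.memLp_sq_four`).

Law of large numbers. Products of regressors are then in `L²`, and von Neumann's ergodic theorem
sends the Gram matrix to `U` in probability. `U` and `R` are nondegenerate: a linear relation among
the regressors would make some `ε_s²` a function of the past, hence independent of itself and
constant (`IsARCH.eq_zero_of_dotProduct_regressor`).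

Central limit theorem. A linear functional of the score is a sum of predictable weights `G_k` times
innovations `ζ_k` that have a fixed law and are independent of the past. For bounded weights, the
expectation of `exp(i s ∑ G_k ζ_k + s²/2 ∑ G_k²)` is close to 1 by a telescoping argument, and the
compensator converges by ergodicity. Truncation, with an `L²` error uniform in `n`, removes the
boundedness (`IsInnovation.tendsto_integral_exp`).

Consistency follows since the score is tight and is divided by `√n`. Normality follows from Lévy's
continuity theorem and Slutsky's lemma. -/

namespace ARCH

/-! ### Matrix powers, the mean ergodic theorem, tightness -/

section Tools

/-- Geometric decay of the entries of the powers of a real matrix whose spectral radius is less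
than one. -/
lemma exists_abs_pow_apply_le {ι : Type*} [Fintype ι] [DecidableEq ι] (M : Matrix ι ι ℝ)
    (hM : spectralRadius ℂ (M.map (fun a : ℝ => (a : ℂ))) < 1) :
    ∃ C r : ℝ, 0 ≤ C ∧ 0 < r ∧ r < 1 ∧ ∀ (k : ℕ) (i j : ι), |(M ^ k) i j| ≤ C * r ^ k := by
  -- The maximal row sum norm is submultiplicative, as Gelfand's formula requires, and it dominates
  -- every entry.
  let _ : NormedRing (Matrix ι ι ℂ) := Matrix.linftyOpNormedRing
  let _ : NormedAlgebra ℂ (Matrix ι ι ℂ) := Matrix.linftyOpNormedAlgebra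
  set A : Matrix ι ι ℂ := M.map (fun a : ℝ => (a : ℂ)) with hA
  have hpow : ∀ k : ℕ, A ^ k = (M ^ k).map (fun a : ℝ => (a : ℂ)) := by
    intro k
    have := (Complex.ofRealHom.mapMatrix (m := ι)).map_pow M k
    simp only [RingHom.mapMatrix_apply] at this
    exact this.symm
  have hent : ∀ (B : Matrix ι ι ℂ) (i j : ι), ‖B i j‖ ≤ ‖B‖ := by
    intro B i j
    rw [Matrix.linfty_opNorm_def]
    have h1 : ‖B i j‖₊ ≤ ∑ j, ‖B i j‖₊ :=
      Finset.single_le_sum (f := fun j => ‖B i j‖₊) (fun _ _ => zero_le) (Finset.mem_univ j)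
    have h2 : ∑ j, ‖B i j‖₊ ≤ Finset.univ.sup fun i => ∑ j, ‖B i j‖₊ :=
      Finset.le_sup (f := fun i => ∑ j, ‖B i j‖₊) (Finset.mem_univ i)
    exact_mod_cast h1.trans h2
  obtain ⟨r, hr1, hr2⟩ := exists_between hM
  have hrtop : r ≠ ⊤ := ne_top_of_lt hr2
  have hr0 : 0 < r.toReal := ENNReal.toReal_pos (pos_of_gt hr1).ne' hrtop
  have hev : ∀ᶠ k : ℕ in atTop, ‖A ^ k‖ ≤ r.toReal ^ k := by
    have h := (spectrum.pow_nnnorm_pow_one_div_tendsto_nhds_spectralRadius A).eventually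
      (gt_mem_nhds hr1)
    filter_upwards [h, eventually_gt_atTop 0] with k hk hk0
    have hk0' : (0 : ℝ) < k := by exact_mod_cast hk0
    have h3 : (‖A ^ k‖₊ : ENNReal) ≤ r ^ k := by
      have := ENNReal.rpow_le_rpow hk.le hk0'.le
      rw [← ENNReal.rpow_mul, one_div, inv_mul_cancel₀ hk0'.ne', ENNReal.rpow_one,
        ENNReal.rpow_natCast] at this
      exact this
    have h4 := ENNReal.toReal_mono (ENNReal.pow_ne_top hrtop) h3
    simpa using h4
  obtain ⟨N, hN⟩ := eventually_atTop.1 hev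
  have hq : ∀ k : ℕ, 0 ≤ ‖A ^ k‖ / r.toReal ^ k := fun k =>
    div_nonneg (norm_nonneg _) (pow_nonneg hr0.le k)
  have hq' := Finset.sum_nonneg fun k (_ : k ∈ Finset.range N) => hq k
  -- Gelfand's formula bounds the powers only from `N` on; the sum of ratios absorbs the finitely
  -- many earlier ones.
  refine ⟨1 + ∑ k ∈ Finset.range N, ‖A ^ k‖ / r.toReal ^ k, r.toReal, by linarith, hr0, ?_, ?_⟩
  · have := (ENNReal.toReal_lt_toReal hrtop ENNReal.one_ne_top).2 hr2
    simpa using this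
  · intro k i j
    have h0 : |(M ^ k) i j| ≤ ‖A ^ k‖ := by
      have := hent (A ^ k) i j
      rw [hpow k] at this ⊢
      simpa using this
    refine h0.trans ?_
    have hrk : 0 < r.toReal ^ k := pow_pos hr0 k
    rw [← div_le_iff₀ hrk]
    by_cases hk : N ≤ k
    · calc ‖A ^ k‖ / r.toReal ^ k ≤ 1 := (div_le_one hrk).2 (hN k hk)
        _ ≤ _ := le_add_of_nonneg_right hq'
    · have := Finset.single_le_sum (f := fun k => ‖A ^ k‖ / r.toReal ^ k)
        (fun k _ => hq k) (Finset.mem_range.2 (not_le.1 hk))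
      linarith

/-- The mean ergodic theorem for a square integrable observable, in probability. -/
lemma tendstoInMeasure_average_of_ergodic {α : Type*} [MeasurableSpace α] {P : Measure α}
    [IsProbabilityMeasure P] {T : α → α} (hT : Ergodic T P) {F : α → ℝ} (hF : MemLp F 2 P) :
    TendstoInMeasure P (fun (n : ℕ) x => (n : ℝ)⁻¹ * ∑ k ∈ Finset.range n, F (T^[k] x)) atTop
      (fun _ => ∫ x, F x ∂P) := by
  have hmp := hT.toMeasurePreserving
  let K : Lp ℝ 2 P →L[ℝ] Lp ℝ 2 P :=
    (Lp.compMeasurePreservingₗᵢ ℝ T hmp : Lp ℝ 2 P →ₗᵢ[ℝ] Lp ℝ 2 P).toContinuousLinearMap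
  have hK : ‖K‖ ≤ 1 := LinearIsometry.norm_toContinuousLinearMap_le _
  have hlim := K.tendsto_birkhoffAverage_orthogonalProjection hK hF.toLp
  set y : Lp ℝ 2 P :=
    ((K.eqLocus (1 : Lp ℝ 2 P →L[ℝ] Lp ℝ 2 P)).orthogonalProjectionOnto hF.toLp : Lp ℝ 2 P)
    with hy
  have hiter : ∀ k : ℕ, K^[k] hF.toLp = (hF.comp_measurePreserving (hmp.iterate k)).toLp := by
    intro k
    have h1 : (K : Lp ℝ 2 P → Lp ℝ 2 P) = Lp.compMeasurePreserving T hmp := rfl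
    rw [h1, ← Lp.toLp_compMeasurePreserving hF (hmp.iterate k),
      Lp.compMeasurePreserving_iterate hmp k]
  have hKy : K y = y := by
    have h := ((K.eqLocus (1 : Lp ℝ 2 P →L[ℝ] Lp ℝ 2 P)).orthogonalProjectionOnto hF.toLp).2
    exact h
  -- The limit `y` is the projection of `F` onto the invariant functions, which ergodicity forces to
  -- be constant.
  obtain ⟨c, hc⟩ : ∃ c, (y : α → ℝ) =ᵐ[P] Function.const α c := by
    refine hT.ae_eq_const_of_ae_eq_comp_ae (Lp.aestronglyMeasurable y) ?_
    have h := Lp.coeFn_compMeasurePreserving y hmp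
    have h' : Lp.compMeasurePreserving T hmp y = y := hKy
    rw [h'] at h
    exact h.symm
  have hcF : c = ∫ x, F x ∂P := by
    -- The constant 1 is invariant, so `F` and its projection have the same inner product with it,
    -- that is, the same integral.
    let e : Lp ℝ 2 P := indicatorConstLp 2 MeasurableSet.univ (measure_ne_top P _) (1 : ℝ)
    have hKe : K e = e := by
      have h1 : (K : Lp ℝ 2 P → Lp ℝ 2 P) = Lp.compMeasurePreserving T hmp := rfl
      rw [h1]
      apply Lp.ext
      have h2 : (e : α → ℝ) =ᵐ[P] fun _ => 1 := by
        filter_upwards [indicatorConstLp_coeFn (p := 2) (hs := MeasurableSet.univ)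
          (hμs := measure_ne_top P _) (c := (1 : ℝ))] with x hx
        rw [hx, Set.indicator_univ]
      have h3 := hmp.quasiMeasurePreserving.ae_eq_comp h2
      filter_upwards [Lp.coeFn_compMeasurePreserving e hmp, h2, h3] with x hx hx2 hx3
      rw [hx, hx3, hx2]
      rfl
    have horth : inner ℝ e hF.toLp = inner ℝ e y := by
      have h := Submodule.starProjection_inner_eq_zero
        (K := K.eqLocus (1 : Lp ℝ 2 P →L[ℝ] Lp ℝ 2 P)) hF.toLp e hKe
      rw [inner_sub_left, sub_eq_zero] at h
      rw [real_inner_comm, h, real_inner_comm]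
      rfl
    rw [L2.inner_indicatorConstLp_one, L2.inner_indicatorConstLp_one] at horth
    simp only [Measure.restrict_univ] at horth
    rw [integral_congr_ae hF.coeFn_toLp, integral_congr_ae hc] at horth
    simpa using horth.symm
  have htm := tendstoInMeasure_of_tendsto_Lp hlim
  refine htm.congr (fun n => ?_) (by rw [← hcF]; exact hc)
  have h1 : birkhoffAverage ℝ K _root_.id n hF.toLp =
      (n : ℝ)⁻¹ • ∑ k ∈ Finset.range n, (hF.comp_measurePreserving (hmp.iterate k)).toLp := by
    simp only [birkhoffAverage, birkhoffSum, id]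
    simp_rw [hiter]
  rw [h1]
  refine (Lp.coeFn_smul _ _).trans ?_
  have h2 : ∀ᵐ x ∂P, ∀ k : ℕ,
      ((hF.comp_measurePreserving (hmp.iterate k)).toLp) x = F (T^[k] x) :=
    ae_all_iff.2 fun k => (hF.comp_measurePreserving (hmp.iterate k)).coeFn_toLp
  filter_upwards [Lp.coeFn_fun_finsetSum (Finset.range n)
    fun k => (hF.comp_measurePreserving (hmp.iterate k)).toLp, h2] with x hx hx2
  rw [Pi.smul_apply, hx, smul_eq_mul]
  simp_rw [hx2]

/-- The product of a sequence that tends to zero in probability and a tight one tends to zero in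
probability. -/
lemma tendstoInMeasure_mul_of_tight {Ω : Type*} [MeasurableSpace Ω] {μ : Measure Ω}
    {U V : ℕ → Ω → ℝ} (hU : TendstoInMeasure μ U atTop (fun _ => 0))
    (hV : ∀ δ : ENNReal, 0 < δ → ∃ K : ℝ, ∀ n, μ {w | K < |V n w|} ≤ δ) :
    TendstoInMeasure μ (fun n w => U n w * V n w) atTop (fun _ => 0) := by
  rw [tendstoInMeasure_iff_norm] at hU ⊢
  intro e he
  rw [ENNReal.tendsto_nhds_zero]
  intro δ hδ
  obtain ⟨K, hK⟩ := hV (δ / 2) (ENNReal.half_pos hδ.ne')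
  -- Tightness does not provide a positive `K`, so `|K| + 1` serves as the divisor.
  have hK1 : 0 < |K| + 1 := by positivity
  have h := (ENNReal.tendsto_nhds_zero.1 (hU (e / (|K| + 1)) (by positivity))) (δ / 2)
    (ENNReal.half_pos hδ.ne')
  filter_upwards [h] with n hn
  calc μ {w | e ≤ ‖U n w * V n w - 0‖}
      ≤ μ ({w | e / (|K| + 1) ≤ ‖U n w - 0‖} ∪ {w | K < |V n w|}) := by
        refine measure_mono fun w hw => ?_
        by_contra hcon
        simp only [Set.mem_union, Set.mem_ofPred_eq, not_or, not_le, not_lt, sub_zero,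
          Real.norm_eq_abs, abs_mul] at hcon hw
        have h1 : |V n w| ≤ |K| + 1 := by linarith [le_abs_self K, hcon.2]
        have h2 : |U n w| * |V n w| < e := by
          calc |U n w| * |V n w| ≤ |U n w| * (|K| + 1) := by gcongr
            _ < e / (|K| + 1) * (|K| + 1) := by gcongr; exact hcon.1
            _ = e := by field_simp
        linarith
    _ ≤ δ / 2 + δ / 2 := (measure_union_le _ _).trans (add_le_add hn (hK n))
    _ = δ := ENNReal.add_halves δ

end Tools

/-! ### A central limit theorem for predictable weights times innovations -/

section MartingaleCLT

/-- The expectations of bounded continuous images of a sequence converging in probability to a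
constant converge. -/
lemma tendsto_integral_comp_of_tendstoInMeasure {Ω : Type*} [MeasurableSpace Ω] {μ : Measure Ω}
    [IsProbabilityMeasure μ] {A : ℕ → Ω → ℝ} {c C : ℝ} {f : ℝ → ℝ} (hf : Continuous f)
    (hA : ∀ n, Measurable (A n)) (hC : ∀ n w, |f (A n w)| ≤ C)
    (h : TendstoInMeasure μ A atTop (fun _ => c)) :
    Tendsto (fun n => ∫ w, f (A n w) ∂μ) atTop (𝓝 (f c)) := by
  -- Along a further subsequence the convergence holds almost everywhere, and dominated convergence
  -- applies.
  refine tendsto_of_subseq_tendsto fun ns hns => ?_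
  obtain ⟨ms, _, hms⟩ := (h.comp hns).exists_seq_tendsto_ae
  refine ⟨ms, ?_⟩
  have := tendsto_integral_of_dominated_convergence (μ := μ) (f := fun _ => f c)
    (F := fun n w => f (A (ns (ms n)) w)) (fun _ => C)
    (fun n => (hf.measurable.comp (hA _)).aestronglyMeasurable) (integrable_const C)
    (fun n => Eventually.of_forall fun w => hC _ w)
    (hms.mono fun w hw => (hf.tendsto c).comp hw)
  simpa using this

/-- Centred and normalized random variables `ζ k`, identically distributed, each of them
independent of the information `ℱ k` available before it is revealed. -/
structure IsInnovation {Ω : Type*} [mΩ : MeasurableSpace Ω] (μ : Measure Ω)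
    (ℱ : ℕ → MeasurableSpace Ω) (ζ : ℕ → Ω → ℝ) (ν : Measure ℝ) : Prop where
  le : ∀ k, ℱ k ≤ mΩ
  mono : Monotone ℱ
  measurable : ∀ k, Measurable[ℱ (k + 1)] (ζ k)
  indep : ∀ k, Indep (MeasurableSpace.comap (ζ k) inferInstance) (ℱ k) μ
  map_eq : ∀ k, μ.map (ζ k) = ν
  mean : ∫ x, x ∂ν = 0
  sq : ∫ x, x ^ 2 ∂ν = 1

variable {Ω : Type*} [mΩ : MeasurableSpace Ω] {μ : Measure Ω}
  {ℱ : ℕ → MeasurableSpace Ω} {ζ : ℕ → Ω → ℝ} {ν : Measure ℝ}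

lemma IsInnovation.meas (h : IsInnovation μ ℱ ζ ν) (k : ℕ) : Measurable (ζ k) :=
  (h.measurable k).mono (h.le _) le_rfl

lemma IsInnovation.isProbabilityMeasure [IsProbabilityMeasure μ] (h : IsInnovation μ ℱ ζ ν) : IsProbabilityMeasure ν := by
  rw [← h.map_eq 0]
  exact Measure.isProbabilityMeasure_map (h.meas 0).aemeasurable

lemma IsInnovation.indepFun (h : IsInnovation μ ℱ ζ ν) {E : Type*} [MeasurableSpace E] {k : ℕ}
    {Y : Ω → E} (hY : Measurable[ℱ k] Y) : IndepFun (ζ k) Y μ :=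
  (IndepFun_iff_Indep _ _ _).2 (indep_of_indep_of_le_right (h.indep k) hY.comap_le)

lemma IsInnovation.integral_eq [IsProbabilityMeasure μ] (h : IsInnovation μ ℱ ζ ν) (k : ℕ) : ∫ w, ζ k w ∂μ = 0 := by
  rw [← h.mean, ← h.map_eq k, integral_map (h.meas k).aemeasurable (by fun_prop)]

lemma IsInnovation.integral_sq_eq [IsProbabilityMeasure μ] (h : IsInnovation μ ℱ ζ ν) (k : ℕ) :
    ∫ w, ζ k w ^ 2 ∂μ = 1 := by
  rw [← h.sq, ← h.map_eq k, integral_map (h.meas k).aemeasurable (by fun_prop)]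

lemma IsInnovation.integrable_sq [IsProbabilityMeasure μ] (h : IsInnovation μ ℱ ζ ν) (k : ℕ) :
    Integrable (fun w => ζ k w ^ 2) μ :=
  .of_integral_ne_zero (by rw [h.integral_sq_eq]; exact one_ne_zero)

lemma IsInnovation.memLp [IsProbabilityMeasure μ] (h : IsInnovation μ ℱ ζ ν) (k : ℕ) : MemLp (ζ k) 2 μ :=
  (memLp_two_iff_integrable_sq (h.meas k).aestronglyMeasurable).2 (h.integrable_sq k)

lemma IsInnovation.sum_measurable (h : IsInnovation μ ℱ ζ ν) {D : ℕ → Ω → ℝ}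
    (hD : ∀ k, Measurable[ℱ k] (D k)) (n : ℕ) :
    Measurable[ℱ n] (fun w => ∑ k ∈ Finset.range n, D k w * ζ k w) := by
  refine Finset.measurable_sum _ fun k hk => ?_
  have hk' := Finset.mem_range.1 hk
  exact ((hD k).mono (h.mono hk'.le) le_rfl).mul ((h.measurable k).mono (h.mono hk') le_rfl)

/-- Orthogonality of martingale differences. -/
lemma IsInnovation.memLp_sum_and_integral_sq [IsProbabilityMeasure μ] (h : IsInnovation μ ℱ ζ ν) {D : ℕ → Ω → ℝ}
    (hD : ∀ k, Measurable[ℱ k] (D k)) (hD2 : ∀ k, MemLp (D k) 2 μ) (n : ℕ) :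
    MemLp (fun w => ∑ k ∈ Finset.range n, D k w * ζ k w) 2 μ ∧
    ∫ w, (∑ k ∈ Finset.range n, D k w * ζ k w) ^ 2 ∂μ =
      ∑ k ∈ Finset.range n, ∫ w, D k w ^ 2 ∂μ := by
  induction n with
  | zero => simp
  | succ n ih =>
    obtain ⟨ih1, ih2⟩ := ih
    have hS := h.sum_measurable hD n
    set S := fun w => ∑ k ∈ Finset.range n, D k w * ζ k w with hSdef
    have hmD : Measurable (D n) := (hD n).mono (h.le n) le_rfl
    have hmS : Measurable S := hS.mono (h.le n) le_rfl
    -- The partial sum and the next weight are both known at stage `n`, so the cross term factors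
    -- and vanishes with the mean of `ζ n`.
    have hi1 : IndepFun (ζ n) (fun w => S w * D n w) μ := h.indepFun (hS.mul (hD n))
    have hi2 : IndepFun (fun w => ζ n w ^ 2) (fun w => D n w ^ 2) μ :=
      (h.indepFun (hD n)).comp (φ := fun x => x ^ 2) (ψ := fun x => x ^ 2) (by fun_prop)
        (by fun_prop)
    have hI1 : Integrable (fun w => ζ n w * (S w * D n w)) μ :=
      hi1.integrable_mul ((h.memLp n).integrable one_le_two) (ih1.integrable_mul (hD2 n))
    have hI2 : Integrable (fun w => ζ n w ^ 2 * D n w ^ 2) μ :=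
      hi2.integrable_mul (h.integrable_sq n) (hD2 n).integrable_sq
    have hE1 : ∫ w, ζ n w * (S w * D n w) ∂μ = 0 := by
      have := hi1.integral_fun_mul_eq_mul_integral (h.meas n).aestronglyMeasurable
        (hmS.mul hmD).aestronglyMeasurable
      rw [this, h.integral_eq, zero_mul]
    have hE2 : ∫ w, ζ n w ^ 2 * D n w ^ 2 ∂μ = ∫ w, D n w ^ 2 ∂μ := by
      have := hi2.integral_fun_mul_eq_mul_integral ((h.meas n).pow_const 2).aestronglyMeasurable
        (hmD.pow_const 2).aestronglyMeasurable
      rw [this, h.integral_sq_eq, one_mul]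
    have hL : MemLp (fun w => D n w * ζ n w) 2 μ := by
      refine (memLp_two_iff_integrable_sq (hmD.mul (h.meas n)).aestronglyMeasurable).2 ?_
      refine hI2.congr (Eventually.of_forall fun w => ?_)
      simp only [Pi.mul_apply]
      ring
    refine ⟨?_, ?_⟩
    · simp_rw [Finset.sum_range_succ]
      exact ih1.add hL
    · simp_rw [Finset.sum_range_succ]
      rw [← ih2, ← hE2]
      have : ∀ w, (∑ k ∈ Finset.range n, D k w * ζ k w + D n w * ζ n w) ^ 2 =
          S w ^ 2 + (2 * (ζ n w * (S w * D n w)) + ζ n w ^ 2 * D n w ^ 2) := by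
        intro w
        simp only [hSdef]
        ring
      simp_rw [this]
      rw [integral_add ih1.integrable_sq (by exact (hI1.const_mul 2).add hI2),
        integral_add (hI1.const_mul 2) (by exact hI2), integral_const_mul, hE1]
      ring

/-- The conditional characteristic function of `ζ k` given the past may be replaced by that of the
normal law, up to the error of the unconditional approximation. -/
lemma IsInnovation.norm_integral_exp_sub_le [IsProbabilityMeasure μ] (h : IsInnovation μ ℱ ζ ν) {k : ℕ} {H : Ω → ℂ}
    {G : Ω → ℝ} (hH : Measurable[ℱ k] H) (hG : Measurable[ℱ k] G) {B δ s : ℝ}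
    (hB : ∀ w, ‖H w‖ ≤ B)
    (hδ : ∀ w, ‖charFun ν (s * G w) - Complex.exp (-((s * G w : ℝ) : ℂ) ^ 2 / 2)‖ ≤ δ) :
    ‖∫ w, H w * (Complex.exp ((s * (G w * ζ k w) : ℝ) * Complex.I) -
      Complex.exp (-((s * G w : ℝ) : ℂ) ^ 2 / 2)) ∂μ‖ ≤ B * δ := by
  have hν := h.isProbabilityMeasure
  have hind : IndepFun (ζ k) (fun w => (H w, G w)) μ := h.indepFun (hH.prodMk hG)
  have hmY : Measurable (fun w => (H w, G w)) :=
    (hH.mono (h.le k) le_rfl).prodMk (hG.mono (h.le k) le_rfl)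
  let c : ℂ × ℝ → ℂ := fun y => Complex.exp (-((s * y.2 : ℝ) : ℂ) ^ 2 / 2)
  let Φ : ℝ × (ℂ × ℝ) → ℂ := fun z =>
    z.2.1 * (Complex.exp ((s * (z.2.2 * z.1) : ℝ) * Complex.I) - c z.2)
  have hΦm : Measurable Φ := by
    simp only [Φ, c]
    fun_prop
  have hcle : ∀ y, ‖c y‖ ≤ 1 := by
    intro y
    simp only [c]
    rw [Complex.norm_exp]
    have : (-((s * y.2 : ℝ) : ℂ) ^ 2 / 2).re = -(s * y.2) ^ 2 / 2 := by
      have : (-((s * y.2 : ℝ) : ℂ) ^ 2 / 2) = ((-(s * y.2) ^ 2 / 2 : ℝ) : ℂ) := by push_cast; ring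
      rw [this, Complex.ofReal_re]
    rw [this, Real.exp_le_one_iff]
    have := sq_nonneg (s * y.2)
    linarith
  -- Independence makes the joint law a product, so conditioning on the past amounts to integrating
  -- out the `ν` variable by Fubini.
  have hmap := hind.map_prod_eq_prod_map_map (h.meas k).aemeasurable hmY.aemeasurable
  rw [h.map_eq k] at hmap
  have hle : ∀ w, ‖Φ (ζ k w, (H w, G w))‖ ≤ B * 2 := by
    intro w
    simp only [Φ]
    rw [norm_mul]
    refine mul_le_mul (hB w) ?_ (norm_nonneg _) ((norm_nonneg _).trans (hB w))
    refine (norm_sub_le _ _).trans ?_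
    rw [Complex.norm_exp_ofReal_mul_I]
    linarith [hcle (H w, G w)]
  have hpair : Measurable (fun w => (ζ k w, (H w, G w))) := (h.meas k).prodMk hmY
  have hint0 : Integrable (fun w => Φ (ζ k w, (H w, G w))) μ :=
    Integrable.of_bound (hΦm.comp hpair).aestronglyMeasurable (B * 2) (Eventually.of_forall hle)
  have hint : Integrable Φ (ν.prod (μ.map fun w => (H w, G w))) := by
    rw [← hmap]
    exact (integrable_map_measure hΦm.aestronglyMeasurable hpair.aemeasurable).2 hint0
  have hinner : ∀ y : ℂ × ℝ, ∫ x, Φ (x, y) ∂ν = y.1 * (charFun ν (s * y.2) - c y) := by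
    intro y
    simp only [Φ]
    rw [integral_const_mul, integral_sub, charFun_apply_real]
    · simp only [integral_const, probReal_univ, one_smul]
      congr 3
      ext x
      push_cast
      ring_nf
    · refine Integrable.of_bound (by fun_prop) 1 (Eventually.of_forall fun x => ?_)
      rw [Complex.norm_exp_ofReal_mul_I]
    · exact integrable_const _
  calc ‖∫ w, H w * (Complex.exp ((s * (G w * ζ k w) : ℝ) * Complex.I) -
        Complex.exp (-((s * G w : ℝ) : ℂ) ^ 2 / 2)) ∂μ‖
      = ‖∫ w, Φ (ζ k w, (H w, G w)) ∂μ‖ := rfl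
    _ = ‖∫ z, Φ z ∂(ν.prod (μ.map fun w => (H w, G w)))‖ := by
        rw [← hmap, integral_map hpair.aemeasurable hΦm.aestronglyMeasurable]
    _ = ‖∫ y, ∫ x, Φ (x, y) ∂ν ∂(μ.map fun w => (H w, G w))‖ := by
        have : IsProbabilityMeasure (μ.map fun w => (H w, G w)) :=
          Measure.isProbabilityMeasure_map hmY.aemeasurable
        rw [integral_prod_symm _ hint]
    _ = ‖∫ w, H w * (charFun ν (s * G w) - c (H w, G w)) ∂μ‖ := by
        simp_rw [hinner]
        rw [integral_map hmY.aemeasurable]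
        have : Measurable fun y : ℂ × ℝ => y.1 * (charFun ν (s * y.2) - c y) := by
          simp only [c]
          fun_prop
        exact this.aestronglyMeasurable
    _ ≤ B * δ := by
        refine (norm_integral_le_of_norm_le_const (C := B * δ)
          (Eventually.of_forall fun w => ?_)).trans (by simp)
        rw [norm_mul]
        exact mul_le_mul (hB w) (hδ w) (norm_nonneg _) ((norm_nonneg _).trans (hB w))

/-- Mean 0 and variance 1 make both functions equal to `1 - x²/2` up to `o(x²)`; no third moment is
needed. -/
lemma exists_norm_charFun_sub_exp_le [IsProbabilityMeasure ν] (hmean : ∫ x, x ∂ν = 0)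
    (hsq : ∫ x, x ^ 2 ∂ν = 1) {c : ℝ} (hc : 0 < c) :
    ∃ r > 0, ∀ x : ℝ, |x| < r →
      ‖charFun ν x - Complex.exp (-(x : ℂ) ^ 2 / 2)‖ ≤ c * x ^ 2 := by
  have h1 : (fun t : ℝ => charFun ν t - (1 - (t : ℂ) ^ 2 / 2)) =o[𝓝 0] fun t => t ^ 2 := by
    have := taylor_charFun_two (P := ν) (X := id) aemeasurable_id (by simpa using hmean)
      (by simpa using hsq)
    simpa using this
  have h2 := Asymptotics.isLittleO_iff.1 h1 (half_pos hc)
  obtain ⟨r, hr, h3⟩ := Metric.eventually_nhds_iff.1 h2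
  refine ⟨min r (min 1 c), by positivity, fun x hx => ?_⟩
  obtain ⟨hx1, hx2⟩ := lt_min_iff.1 hx
  obtain ⟨hx2, hx3⟩ := lt_min_iff.1 hx2
  have h4 := h3 (y := x) (by simpa using hx1)
  have hx0 := abs_nonneg x
  have hy : ‖-(x : ℂ) ^ 2 / 2‖ = x ^ 2 / 2 := by
    simp [← Complex.ofReal_pow]
  have hx4 : x ^ 2 ≤ |x| := by
    rw [← sq_abs]
    nlinarith
  have h5 := Complex.norm_exp_sub_one_sub_id_le (x := -(x : ℂ) ^ 2 / 2) (by rw [hy]; linarith)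
  rw [hy] at h5
  have h6 : ‖(x ^ 2 : ℝ)‖ = x ^ 2 := by rw [Real.norm_eq_abs, abs_of_nonneg (sq_nonneg x)]
  rw [h6] at h4
  have h7 : charFun ν x - Complex.exp (-(x : ℂ) ^ 2 / 2) =
      (charFun ν x - (1 - (x : ℂ) ^ 2 / 2)) -
        (Complex.exp (-(x : ℂ) ^ 2 / 2) - 1 - -(x : ℂ) ^ 2 / 2) := by ring
  rw [h7]
  refine (norm_sub_le _ _).trans ?_
  nlinarith [sq_nonneg x]

/-- Telescoping estimate for the exponential of the martingale, compensated as if the innovations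
were normal. -/
lemma IsInnovation.norm_integral_compensated_sub_one_le [IsProbabilityMeasure μ]
    (h : IsInnovation μ ℱ ζ ν)
    {G : ℕ → Ω → ℝ} (hG : ∀ k, Measurable[ℱ k] (G k)) {K δ s : ℝ} (hK : ∀ k w, |G k w| ≤ K)
    (hδ : ∀ x : ℝ, |x| ≤ |s| * K → ‖charFun ν x - Complex.exp (-(x : ℂ) ^ 2 / 2)‖ ≤ δ)
    (n m : ℕ) (hm : m ≤ n) :
    ‖(∫ w, Complex.exp ((s * ∑ k ∈ Finset.range m, G k w * ζ k w : ℝ) * Complex.I +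
      (s ^ 2 / 2 * ∑ k ∈ Finset.range m, G k w ^ 2 : ℝ)) ∂μ) - 1‖ ≤
      m * (Real.exp (s ^ 2 / 2 * (n * K ^ 2)) * δ) := by
  have hsq : ∀ k w, G k w ^ 2 ≤ K ^ 2 := fun k w => by
    rw [← sq_abs (G k w)]
    exact pow_le_pow_left₀ (abs_nonneg _) (hK k w) 2
  have hmG : ∀ k j, k ≤ j → Measurable[ℱ j] (fun w => ∑ i ∈ Finset.range (k + 1), G i w ^ 2) :=
    fun k j hkj => Finset.measurable_sum _ fun i hi => by
      have hi' : i ≤ j := (Nat.lt_succ_iff.1 (Finset.mem_range.1 hi)).trans hkj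
      exact ((hG i).mono (h.mono hi') le_rfl).pow_const 2
  have hbd : ∀ k, k ≤ n → ∀ w, s ^ 2 / 2 * ∑ i ∈ Finset.range k, G i w ^ 2 ≤
      s ^ 2 / 2 * (n * K ^ 2) := by
    intro k hk w
    gcongr
    calc ∑ i ∈ Finset.range k, G i w ^ 2 ≤ ∑ i ∈ Finset.range k, K ^ 2 :=
          Finset.sum_le_sum fun i _ => hsq i w
      _ = k * K ^ 2 := by simp
      _ ≤ n * K ^ 2 := by gcongr
  have hnorm : ∀ a b : ℝ, ‖Complex.exp ((a : ℂ) * Complex.I + (b : ℂ))‖ = Real.exp b := by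
    intro a b
    rw [Complex.norm_exp]
    simp
  induction m with
  | zero => simp
  | succ m ih =>
    have ih := ih (by omega)
    -- The compensator runs one index further than the sum. It is still known at stage `m` because
    -- `G m` is predictable, and with this choice `H` times the difference of exponentials is
    -- exactly the telescoping increment.
    let H : Ω → ℂ := fun w => Complex.exp
      ((s * ∑ k ∈ Finset.range m, G k w * ζ k w : ℝ) * Complex.I +
        (s ^ 2 / 2 * ∑ k ∈ Finset.range (m + 1), G k w ^ 2 : ℝ))
    have hH : Measurable[ℱ m] H := by
      refine Complex.measurable_exp.comp ?_
      refine Measurable.add (Measurable.mul_const (Complex.measurable_ofReal.comp ?_) _)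
        (Complex.measurable_ofReal.comp ?_)
      · exact (h.sum_measurable hG m).const_mul s
      · exact (hmG m m le_rfl).const_mul _
    have hkey := h.norm_integral_exp_sub_le (δ := δ) (s := s)
      (B := Real.exp (s ^ 2 / 2 * (n * K ^ 2))) hH (hG m)
      (fun w => by
        simp only [H]
        rw [hnorm]
        exact Real.exp_le_exp.2 (hbd _ hm w))
      (fun w => hδ _ (by rw [abs_mul]; gcongr; exact hK m w))
    have hmS : ∀ k, Measurable (fun w => ∑ i ∈ Finset.range k, G i w * ζ i w) := fun k =>
      (h.sum_measurable hG k).mono (h.le k) le_rfl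
    have hmQ : ∀ k, Measurable (fun w => ∑ i ∈ Finset.range k, G i w ^ 2) := fun k =>
      Finset.measurable_sum _ fun i _ => ((hG i).mono (h.le i) le_rfl).pow_const 2
    have hint : ∀ k, k ≤ n → Integrable (fun w => Complex.exp
        ((s * ∑ i ∈ Finset.range k, G i w * ζ i w : ℝ) * Complex.I +
          (s ^ 2 / 2 * ∑ i ∈ Finset.range k, G i w ^ 2 : ℝ))) μ := by
      intro k hk
      refine Integrable.of_bound ?_ (Real.exp (s ^ 2 / 2 * (n * K ^ 2)))
        (Eventually.of_forall fun w => ?_)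
      · have h1 := hmS k
        have h2 := hmQ k
        exact Measurable.aestronglyMeasurable (by fun_prop)
      · rw [hnorm]
        exact Real.exp_le_exp.2 (hbd _ hk w)
    have hdiff : ∀ w, H w * (Complex.exp ((s * (G m w * ζ m w) : ℝ) * Complex.I) -
        Complex.exp (-((s * G m w : ℝ) : ℂ) ^ 2 / 2)) =
        Complex.exp ((s * ∑ k ∈ Finset.range (m + 1), G k w * ζ k w : ℝ) * Complex.I +
          (s ^ 2 / 2 * ∑ k ∈ Finset.range (m + 1), G k w ^ 2 : ℝ)) -
        Complex.exp ((s * ∑ k ∈ Finset.range m, G k w * ζ k w : ℝ) * Complex.I +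
          (s ^ 2 / 2 * ∑ k ∈ Finset.range m, G k w ^ 2 : ℝ)) := by
      intro w
      simp only [H]
      rw [mul_sub, ← Complex.exp_add, ← Complex.exp_add]
      simp only [Finset.sum_range_succ]
      congr 2
      · push_cast
        ring
      · push_cast
        ring
    simp_rw [hdiff] at hkey
    rw [integral_sub (hint (m + 1) hm) (hint m (by omega))] at hkey
    have hsplit : ∀ a b : ℂ, a - 1 = (a - b) + (b - 1) := fun a b => by ring
    rw [hsplit _ (∫ w, Complex.exp ((s * ∑ k ∈ Finset.range m, G k w * ζ k w : ℝ) * Complex.I +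
      (s ^ 2 / 2 * ∑ k ∈ Finset.range m, G k w ^ 2 : ℝ)) ∂μ)]
    refine (norm_add_le _ _).trans ?_
    refine (add_le_add hkey ih).trans (le_of_eq ?_)
    push_cast
    ring

/-- The central limit theorem for bounded predictable weights. -/
lemma IsInnovation.tendsto_integral_exp_of_bounded [IsProbabilityMeasure μ]
    (h : IsInnovation μ ℱ ζ ν)
    {G : ℕ → Ω → ℝ} (hG : ∀ k, Measurable[ℱ k] (G k)) {K c : ℝ} (hK : ∀ k w, |G k w| ≤ K)
    (hlim : TendstoInMeasure μ (fun (n : ℕ) w => (n : ℝ)⁻¹ * ∑ k ∈ Finset.range n, G k w ^ 2)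
      atTop (fun _ => c)) (u : ℝ) :
    Tendsto (fun n : ℕ => ∫ w, Complex.exp
      ((u / √n * ∑ k ∈ Finset.range n, G k w * ζ k w : ℝ) * Complex.I) ∂μ) atTop
      (𝓝 (Complex.exp (-(u ^ 2 / 2 * c : ℝ)))) := by
  have hν := h.isProbabilityMeasure
  have hK0 : 0 ≤ K := by
    obtain ⟨w⟩ : Nonempty Ω := nonempty_of_isProbabilityMeasure μ
    exact (abs_nonneg _).trans (hK 0 w)
  have hsq : ∀ n : ℕ, 0 < n → (u / √n) ^ 2 = u ^ 2 / n := fun n _ => by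
    rw [div_pow, Real.sq_sqrt (Nat.cast_nonneg n)]
  let M : ℕ → Ω → ℂ := fun n w => Complex.exp
    ((u / √n * ∑ k ∈ Finset.range n, G k w * ζ k w : ℝ) * Complex.I +
      ((u / √n) ^ 2 / 2 * ∑ k ∈ Finset.range n, G k w ^ 2 : ℝ))
  have hM : Tendsto (fun n => ∫ w, M n w ∂μ) atTop (𝓝 1) := by
    rw [Metric.tendsto_nhds]
    intro e he
    set E := Real.exp (u ^ 2 / 2 * K ^ 2) with hE
    have hEpos : 0 < E := Real.exp_pos _
    -- The `n` telescoping errors are each of order `c' u² K² E / n`, so their sum stays below `e`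
    -- for this `c'`; the `+ 1` avoids division by zero.
    have hc' : 0 < e / 2 / (u ^ 2 * K ^ 2 * E + 1) := by positivity
    obtain ⟨r, hr, hr'⟩ := exists_norm_charFun_sub_exp_le h.mean h.sq hc'
    have hsm : Tendsto (fun n : ℕ => |u / √n| * K) atTop (𝓝 0) := by
      have h1 : Tendsto (fun n : ℕ => √(n : ℝ)) atTop atTop :=
        Real.tendsto_sqrt_atTop.comp tendsto_natCast_atTop_atTop
      simpa using ((h1.const_div_atTop u).abs).mul_const K
    filter_upwards [hsm.eventually (gt_mem_nhds hr), eventually_gt_atTop 0] with n hn hn0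
    have hn0' : (0 : ℝ) < n := by exact_mod_cast hn0
    have hb := h.norm_integral_compensated_sub_one_le hG (s := u / √n) hK
      (δ := e / 2 / (u ^ 2 * K ^ 2 * E + 1) * (|u / √n| * K) ^ 2)
      (fun x hx => (hr' x (hx.trans_lt hn)).trans (by
        rw [← sq_abs x]
        gcongr)) n n le_rfl
    rw [dist_eq_norm]
    refine hb.trans_lt ?_
    rw [mul_pow, sq_abs, hsq n hn0]
    have h2 : u ^ 2 / n / 2 * (n * K ^ 2) = u ^ 2 / 2 * K ^ 2 := by field_simp
    rw [h2, ← hE]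
    have h3 : n * (E * (e / 2 / (u ^ 2 * K ^ 2 * E + 1) * (u ^ 2 / n * K ^ 2))) =
        e / 2 * ((u ^ 2 * K ^ 2 * E) / (u ^ 2 * K ^ 2 * E + 1)) := by
      field_simp
    rw [h3]
    have h4 : (u ^ 2 * K ^ 2 * E) / (u ^ 2 * K ^ 2 * E + 1) ≤ 1 := by
      rw [div_le_one (by positivity)]
      linarith
    nlinarith
  have hmS : ∀ n, Measurable (fun w => ∑ i ∈ Finset.range n, G i w * ζ i w) := fun k =>
    (h.sum_measurable hG k).mono (h.le k) le_rfl
  have hmQ : ∀ n, Measurable (fun w => ∑ i ∈ Finset.range n, G i w ^ 2) := fun k =>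
    Finset.measurable_sum _ fun i _ => ((hG i).mono (h.le i) le_rfl).pow_const 2
  let A : ℕ → Ω → ℝ := fun n w => (n : ℝ)⁻¹ * ∑ k ∈ Finset.range n, G k w ^ 2
  have hA0 : ∀ n w, 0 ≤ A n w := fun n w => by positivity
  have hAK : ∀ n w, A n w ≤ K ^ 2 := by
    intro n w
    have h1 : ∑ k ∈ Finset.range n, G k w ^ 2 ≤ n * K ^ 2 := by
      calc ∑ i ∈ Finset.range n, G i w ^ 2 ≤ ∑ i ∈ Finset.range n, K ^ 2 :=
            Finset.sum_le_sum fun i _ => by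
              rw [← sq_abs (G i w)]
              exact pow_le_pow_left₀ (abs_nonneg _) (hK i w) 2
        _ = n * K ^ 2 := by simp
    rcases Nat.eq_zero_or_pos n with rfl | hn
    · simp [A, sq_nonneg]
    · have hn0' : (0 : ℝ) < n := by exact_mod_cast hn
      simp only [A]
      rw [inv_mul_le_iff₀ hn0']
      exact h1
  have hAm : ∀ n, Measurable (A n) := fun n => (hmQ n).const_mul _
  have hdiff : Tendsto (fun n => ∫ w, |1 - Real.exp (u ^ 2 / 2 * (A n w - c))| ∂μ) atTop (𝓝 0) := by
    have := tendsto_integral_comp_of_tendstoInMeasure (μ := μ) (A := A) (c := c)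
      (C := 1 + Real.exp (u ^ 2 / 2 * (K ^ 2 - c)))
      (f := fun a => |1 - Real.exp (u ^ 2 / 2 * (a - c))|) (by fun_prop) hAm
      (fun n w => by
        rw [abs_abs]
        refine (abs_sub _ _).trans ?_
        rw [abs_one, Real.abs_exp]
        gcongr
        exact hAK n w) hlim
    simpa using this
  have hintS : ∀ n : ℕ, Integrable (fun w => Complex.exp
      ((u / √n * ∑ k ∈ Finset.range n, G k w * ζ k w : ℝ) * Complex.I)) μ := by
    intro n
    refine Integrable.of_bound ?_ 1 (Eventually.of_forall fun w => ?_)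
    · have h1 := hmS n
      exact Measurable.aestronglyMeasurable (by fun_prop)
    · rw [Complex.norm_exp_ofReal_mul_I]
  have hMn : ∀ n, 0 < n → ∀ w, M n w = Complex.exp
      ((u / √n * ∑ k ∈ Finset.range n, G k w * ζ k w : ℝ) * Complex.I) *
        (Real.exp (u ^ 2 / 2 * A n w) : ℝ) := by
    intro n hn w
    have hn0' : (n : ℝ) ≠ 0 := by exact_mod_cast hn.ne'
    simp only [M]
    rw [hsq n hn, Complex.ofReal_exp, ← Complex.exp_add]
    congr 3
    simp only [A]
    field_simp
  have hintM : ∀ n, 0 < n → Integrable (M n) μ := by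
    intro n hn
    refine Integrable.of_bound ?_ (Real.exp (u ^ 2 / 2 * K ^ 2)) (Eventually.of_forall fun w => ?_)
    · have h1 := hmS n
      have h2 := hmQ n
      exact Measurable.aestronglyMeasurable (by fun_prop)
    · rw [hMn n hn, norm_mul, Complex.norm_exp_ofReal_mul_I, one_mul, Complex.norm_real,
        Real.norm_eq_abs, Real.abs_exp]
      exact Real.exp_le_exp.2 (mul_le_mul_of_nonneg_left (hAK n w) (by positivity))
  -- The integrand factors as a unimodular exponential times `1 - exp(u²/2 (A n - c))`, which tends
  -- to 0 in mean since `A n` tends to `c` in probability.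
  have hz : Tendsto (fun n : ℕ => (∫ w, Complex.exp
      ((u / √n * ∑ k ∈ Finset.range n, G k w * ζ k w : ℝ) * Complex.I) ∂μ) -
        Complex.exp (-(u ^ 2 / 2 * c : ℝ)) * ∫ w, M n w ∂μ) atTop (𝓝 0) := by
    refine squeeze_zero_norm' ?_ hdiff
    filter_upwards [eventually_gt_atTop 0] with n hn
    rw [← integral_const_mul, ← integral_sub (hintS n) ((hintM n hn).const_mul _)]
    refine (norm_integral_le_integral_norm _).trans (le_of_eq ?_)
    congr 1
    ext w
    rw [hMn n hn w]
    have : Complex.exp ((u / √n * ∑ k ∈ Finset.range n, G k w * ζ k w : ℝ) * Complex.I) -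
        Complex.exp (-(u ^ 2 / 2 * c : ℝ)) * (Complex.exp
          ((u / √n * ∑ k ∈ Finset.range n, G k w * ζ k w : ℝ) * Complex.I) *
            (Real.exp (u ^ 2 / 2 * A n w) : ℝ)) =
        Complex.exp ((u / √n * ∑ k ∈ Finset.range n, G k w * ζ k w : ℝ) * Complex.I) *
          ((1 - Real.exp (u ^ 2 / 2 * (A n w - c)) : ℝ) : ℂ) := by
      have h3 : Real.exp (u ^ 2 / 2 * (A n w - c)) =
          Real.exp (-(u ^ 2 / 2 * c)) * Real.exp (u ^ 2 / 2 * A n w) := by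
        rw [← Real.exp_add]
        ring_nf
      rw [h3]
      push_cast
      ring
    rw [this, norm_mul, Complex.norm_exp_ofReal_mul_I, one_mul, Complex.norm_real,
      Real.norm_eq_abs]
  have := hz.add (hM.const_mul (Complex.exp (-(u ^ 2 / 2 * c : ℝ))))
  simpa using this

/-- This is nonnegativity of the variance of `|f|`. -/
lemma integral_abs_le_sqrt [IsProbabilityMeasure μ] {f : Ω → ℝ} (hf : MemLp f 2 μ) :
    ∫ w, |f w| ∂μ ≤ √(∫ w, f w ^ 2 ∂μ) := by
  refine Real.le_sqrt_of_sq_le ?_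
  have h1 := variance_nonneg (fun w => |f w|) μ
  rw [variance_eq_sub (by simpa using hf.norm)] at h1
  simp only [Pi.pow_apply, sq_abs] at h1
  linarith

lemma norm_exp_mul_I_sub_le (a b : ℝ) :
    ‖Complex.exp (a * Complex.I) - Complex.exp (b * Complex.I)‖ ≤ |a - b| := by
  have h : Complex.exp (a * Complex.I) - Complex.exp (b * Complex.I) =
      Complex.exp (b * Complex.I) * (Complex.exp (Complex.I * ((a - b : ℝ) : ℂ)) - 1) := by
    rw [mul_sub, ← Complex.exp_add, mul_one]
    congr 2
    push_cast
    ring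
  rw [h, norm_mul, Complex.norm_exp_ofReal_mul_I, one_mul]
  exact Real.norm_exp_I_mul_ofReal_sub_one_le

/-- Second moment of the normalized sum. -/
lemma IsInnovation.integral_sq_normalized_le [IsProbabilityMeasure μ] (h : IsInnovation μ ℱ ζ ν)
    {D : ℕ → Ω → ℝ} (hD : ∀ k, Measurable[ℱ k] (D k)) (hD2 : ∀ k, MemLp (D k) 2 μ) {v : ℝ}
    (hv0 : 0 ≤ v) (hv : ∀ k, ∫ w, D k w ^ 2 ∂μ = v) (u : ℝ) (n : ℕ) :
    ∫ w, (u / √n * ∑ k ∈ Finset.range n, D k w * ζ k w) ^ 2 ∂μ ≤ u ^ 2 * v := by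
  simp_rw [mul_pow]
  rw [integral_const_mul, (h.memLp_sum_and_integral_sq hD hD2 n).2]
  simp_rw [hv]
  -- The case `n = 0` gives 0 on the left, which is why the bound is an inequality; for `n > 0`
  -- there is equality.
  rcases Nat.eq_zero_or_pos n with rfl | hn
  · simp only [Finset.range_zero, Finset.sum_empty, mul_zero]
    positivity
  · have hn0' : (0 : ℝ) < n := by exact_mod_cast hn
    rw [div_pow, Real.sq_sqrt hn0'.le]
    simp only [Finset.sum_const, Finset.card_range, nsmul_eq_mul]
    apply le_of_eq
    field_simp

/-- The normalized sums are tight. -/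
lemma IsInnovation.tight_normalized [IsProbabilityMeasure μ] (h : IsInnovation μ ℱ ζ ν)
    {D : ℕ → Ω → ℝ} (hD : ∀ k, Measurable[ℱ k] (D k)) (hD2 : ∀ k, MemLp (D k) 2 μ) {v : ℝ}
    (hv : ∀ k, ∫ w, D k w ^ 2 ∂μ = v) (δ : ENNReal) (hδ : 0 < δ) :
    ∃ K : ℝ, ∀ n : ℕ, μ {w | K < |1 / √n * ∑ k ∈ Finset.range n, D k w * ζ k w|} ≤ δ := by
  have hv0 : 0 ≤ v := by
    rw [← hv 0]
    exact integral_nonneg fun w => sq_nonneg _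
  rcases eq_or_ne δ ⊤ with rfl | hδt
  · exact ⟨0, fun n => le_top⟩
  have hd : 0 < δ.toReal := ENNReal.toReal_pos hδ.ne' hδt
  -- Chebyshev's bound at level `v / δ`; the `+ 1` keeps the level positive when `v = 0`.
  refine ⟨√(v / δ.toReal + 1), fun n => ?_⟩
  set W : Ω → ℝ := fun w => 1 / √n * ∑ k ∈ Finset.range n, D k w * ζ k w with hW
  have hWL : MemLp W 2 μ := (h.memLp_sum_and_integral_sq hD hD2 n).1.const_mul _
  have hE : ∫ w, W w ^ 2 ∂μ ≤ v := by
    have := h.integral_sq_normalized_le hD hD2 hv0 hv 1 n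
    rwa [one_pow, one_mul] at this
  have hpos : 0 < v / δ.toReal + 1 := by positivity
  have hM := mul_meas_ge_le_integral_of_nonneg (μ := μ) (f := fun w => W w ^ 2)
    (Eventually.of_forall fun w => sq_nonneg _) hWL.integrable_sq (v / δ.toReal + 1)
  have h1 : μ.real {w | v / δ.toReal + 1 ≤ W w ^ 2} ≤ δ.toReal := by
    by_contra hcon
    push Not at hcon
    have h2 : (v / δ.toReal + 1) * δ.toReal ≤ v :=
      (mul_le_mul_of_nonneg_left hcon.le hpos.le).trans (hM.trans hE)
    have h3 : (v / δ.toReal + 1) * δ.toReal = v + δ.toReal := by field_simp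
    linarith
  have h4 : μ {w | v / δ.toReal + 1 ≤ W w ^ 2} ≤ δ := by
    rw [← ENNReal.toReal_le_toReal (measure_ne_top _ _) hδt]
    exact h1
  refine (measure_mono fun w hw => ?_).trans h4
  have hw' : √(v / δ.toReal + 1) < |W w| := hw
  have := (Real.sqrt_lt_sqrt_iff hpos.le).1 (by rwa [← Real.sqrt_sq_eq_abs] at hw')
  exact this.le

/-- Truncation to the interval `[-K, K]`. -/
noncomputable def truncate (K x : ℝ) : ℝ := if |x| ≤ K then x else 0

lemma measurable_truncate (K : ℝ) : Measurable (truncate K) :=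
  Measurable.ite (measurableSet_le measurable_norm measurable_const) measurable_id
    measurable_const

lemma abs_truncate_le {K : ℝ} (hK : 0 ≤ K) (x : ℝ) : |truncate K x| ≤ K := by
  unfold truncate
  split_ifs with h
  · exact h
  · simpa using hK

lemma abs_truncate_le_abs (K x : ℝ) : |truncate K x| ≤ |x| := by
  unfold truncate
  split_ifs with h
  · exact le_rfl
  · simp

/-- Large values are sent to 0 rather than clipped, so either the truncation or the remainder
vanishes and there is no cross term. -/
lemma truncate_sq_add_sub_sq (K x : ℝ) : truncate K x ^ 2 + (x - truncate K x) ^ 2 = x ^ 2 := by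
  unfold truncate
  split_ifs <;> ring

lemma tendsto_truncate (x : ℝ) : Tendsto (fun K : ℕ => truncate K x) atTop (𝓝 x) := by
  refine tendsto_const_nhds.congr' ?_
  filter_upwards [tendsto_natCast_atTop_atTop.eventually (eventually_ge_atTop |x|)] with K hK
  simp [truncate, hK]

/-- The central limit theorem for stationary square integrable predictable weights that satisfy
the law of large numbers. -/
lemma IsInnovation.tendsto_integral_exp [IsProbabilityMeasure μ] (h : IsInnovation μ ℱ ζ ν)
    {G : ℕ → Ω → ℝ} (hG : ∀ k, Measurable[ℱ k] (G k)) (hG2 : MemLp (G 0) 2 μ)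
    (hident : ∀ k, IdentDistrib (G k) (G 0) μ μ)
    (hlim : ∀ f : ℝ → ℝ, Measurable f → (∃ C, ∀ x, |f x| ≤ C) →
      TendstoInMeasure μ (fun (n : ℕ) w => (n : ℝ)⁻¹ * ∑ k ∈ Finset.range n, f (G k w))
        atTop (fun _ => ∫ w, f (G 0 w) ∂μ)) (u : ℝ) :
    Tendsto (fun n : ℕ => ∫ w, Complex.exp
      ((u / √n * ∑ k ∈ Finset.range n, G k w * ζ k w : ℝ) * Complex.I) ∂μ) atTop
      (𝓝 (Complex.exp (-(u ^ 2 / 2 * ∫ w, G 0 w ^ 2 ∂μ : ℝ)))) := by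
  have hmG : ∀ k, Measurable (G k) := fun k => (hG k).mono (h.le k) le_rfl
  -- `c K` is the limiting variance for weights truncated at `K`, and `τ K` is the second moment of
  -- what truncation discards.
  let c : ℕ → ℝ := fun K => ∫ w, truncate K (G 0 w) ^ 2 ∂μ
  let τ : ℕ → ℝ := fun K => ∫ w, (G 0 w - truncate K (G 0 w)) ^ 2 ∂μ
  have hc : Tendsto c atTop (𝓝 (∫ w, G 0 w ^ 2 ∂μ)) := by
    refine tendsto_integral_of_dominated_convergence (fun w => G 0 w ^ 2)
      (fun K => (((measurable_truncate K).comp (hmG 0)).pow_const 2).aestronglyMeasurable)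
      hG2.integrable_sq (fun K => Eventually.of_forall fun w => ?_)
      (Eventually.of_forall fun w => (tendsto_truncate _).pow 2)
    rw [Real.norm_eq_abs, abs_of_nonneg (sq_nonneg _)]
    exact sq_le_sq.2 (abs_truncate_le_abs _ _)
  have hsqi : ∀ K : ℕ, Integrable (fun w => truncate K (G 0 w) ^ 2) μ := fun K => by
    refine hG2.integrable_sq.mono'
      ((((measurable_truncate K).comp (hmG 0)).pow_const 2).aestronglyMeasurable)
      (Eventually.of_forall fun w => ?_)
    rw [Real.norm_eq_abs, abs_of_nonneg (sq_nonneg _)]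
    exact sq_le_sq.2 (abs_truncate_le_abs _ _)
  have hτeq : ∀ K, τ K = (∫ w, G 0 w ^ 2 ∂μ) - c K := by
    intro K
    simp only [τ, c]
    rw [← integral_sub hG2.integrable_sq (hsqi K)]
    congr 1
    ext w
    linarith [truncate_sq_add_sub_sq K (G 0 w)]
  have hτ : Tendsto (fun K => |u| * √(τ K)) atTop (𝓝 0) := by
    have h1 : Tendsto τ atTop (𝓝 0) := by
      rw [show τ = _ from funext hτeq]
      have h2 := hc.const_sub (∫ w, G 0 w ^ 2 ∂μ)
      rwa [sub_self] at h2
    simpa using (h1.sqrt).const_mul |u|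
  have hτ0 : ∀ K, 0 ≤ τ K := fun K => integral_nonneg fun w => sq_nonneg _
  have hGt : ∀ K : ℕ, ∀ k, Measurable[ℱ k] (fun w => truncate K (G k w)) := fun K k =>
    (measurable_truncate K).comp (hG k)
  have hdiffL : ∀ (K k : ℕ), MemLp (fun w => G k w - truncate K (G k w)) 2 μ := by
    intro K k
    have hGk : MemLp (G k) 2 μ := (hident k).memLp_iff.2 hG2
    refine hGk.mono ((hmG k).sub ((measurable_truncate K).comp (hmG k))).aestronglyMeasurable
      (Eventually.of_forall fun w => ?_)
    unfold truncate
    split_ifs <;> simp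
  have hτk : ∀ (K k : ℕ), ∫ w, (G k w - truncate K (G k w)) ^ 2 ∂μ = τ K := fun K k =>
    ((hident k).comp (u := fun x => (x - truncate K x) ^ 2)
      ((measurable_id.sub (measurable_truncate K)).pow_const 2)).integral_eq
  have hintS : ∀ (D : ℕ → Ω → ℝ), (∀ k, Measurable[ℱ k] (D k)) → ∀ n : ℕ,
      Integrable (fun w => Complex.exp
        ((u / √n * ∑ k ∈ Finset.range n, D k w * ζ k w : ℝ) * Complex.I)) μ := by
    intro D hD n
    refine Integrable.of_bound ?_ 1 (Eventually.of_forall fun w => ?_)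
    · have h1 := (h.sum_measurable hD n).mono (h.le n) le_rfl
      exact Measurable.aestronglyMeasurable (by fun_prop)
    · rw [Complex.norm_exp_ofReal_mul_I]
  -- By orthogonality the truncation error is controlled in `L²` uniformly in `n`, which permits
  -- choosing `K` before letting `n` grow.
  have hclose : ∀ K n : ℕ, ‖(∫ w, Complex.exp
      ((u / √n * ∑ k ∈ Finset.range n, G k w * ζ k w : ℝ) * Complex.I) ∂μ) -
      ∫ w, Complex.exp
      ((u / √n * ∑ k ∈ Finset.range n, truncate K (G k w) * ζ k w : ℝ) * Complex.I) ∂μ‖ ≤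
      |u| * √(τ K) := by
    intro K n
    rw [← integral_sub (hintS _ hG n) (hintS _ (hGt K) n)]
    set D : ℕ → Ω → ℝ := fun k w => G k w - truncate K (G k w)
    have hD : ∀ k, Measurable[ℱ k] (D k) := fun k => (hG k).sub (hGt K k)
    have hW : MemLp (fun w => u / √n * ∑ k ∈ Finset.range n, D k w * ζ k w) 2 μ :=
      (h.memLp_sum_and_integral_sq hD (hdiffL K) n).1.const_mul _
    calc _ ≤ ∫ w, |u / √n * ∑ k ∈ Finset.range n, D k w * ζ k w| ∂μ := by
          refine norm_integral_le_of_norm_le (hW.integrable one_le_two).abs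
            (Eventually.of_forall fun w => ?_)
          refine (norm_exp_mul_I_sub_le _ _).trans (le_of_eq ?_)
          simp only [D, sub_mul, Finset.sum_sub_distrib, mul_sub]
      _ ≤ √(∫ w, (u / √n * ∑ k ∈ Finset.range n, D k w * ζ k w) ^ 2 ∂μ) :=
          integral_abs_le_sqrt hW
      _ ≤ √(u ^ 2 * τ K) := Real.sqrt_le_sqrt
          (h.integral_sq_normalized_le hD (hdiffL K) (hτ0 K) (hτk K) u n)
      _ = |u| * √(τ K) := by rw [Real.sqrt_mul (sq_nonneg u), Real.sqrt_sq_eq_abs]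
  have hbdd : ∀ K : ℕ, Tendsto (fun n : ℕ => ∫ w, Complex.exp
      ((u / √n * ∑ k ∈ Finset.range n, truncate K (G k w) * ζ k w : ℝ) * Complex.I) ∂μ) atTop
      (𝓝 (Complex.exp (-(u ^ 2 / 2 * c K : ℝ)))) := by
    intro K
    refine h.tendsto_integral_exp_of_bounded (hGt K) (K := K)
      (fun k w => abs_truncate_le (Nat.cast_nonneg K) _) ?_ u
    -- Only bounded functions of the weights are averaged: the untruncated squares are merely
    -- integrable, out of reach of the `L²` ergodic theorem.
    refine hlim (fun x => truncate K x ^ 2) ((measurable_truncate K).pow_const 2) ⟨K ^ 2, ?_⟩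
    intro x
    rw [abs_pow]
    exact pow_le_pow_left₀ (abs_nonneg _) (abs_truncate_le (Nat.cast_nonneg K) _) 2
  have hLK : Tendsto (fun K => Complex.exp (-(u ^ 2 / 2 * c K : ℝ))) atTop
      (𝓝 (Complex.exp (-(u ^ 2 / 2 * ∫ w, G 0 w ^ 2 ∂μ : ℝ)))) := by
    refine (Complex.continuous_exp.tendsto _).comp (Tendsto.neg ?_)
    exact (Complex.continuous_ofReal.tendsto _).comp (hc.const_mul _)
  rw [Metric.tendsto_nhds]
  intro e he
  obtain ⟨K, hK1, hK2⟩ := ((hτ.eventually (gt_mem_nhds (show (0 : ℝ) < e / 3 by positivity))).and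
    ((Metric.tendsto_nhds.1 hLK) (e / 3) (by positivity))).exists
  filter_upwards [Metric.tendsto_nhds.1 (hbdd K) (e / 3) (by positivity)] with n hn
  have h1 := hclose K n
  rw [← dist_eq_norm] at h1
  exact (dist_triangle4 _ _ _ _).trans_lt
    ((add_lt_add (add_lt_add (h1.trans_lt hK1) hn) hK2).trans_eq (add_thirds e))

end MartingaleCLT

/-! ### Continuous mapping for convergence in probability -/

section ContinuousMapping

variable {Ω : Type*} [MeasurableSpace Ω] {μ : Measure Ω}

/-- Convergence in probability of finitely many coordinates is joint. -/
lemma tendstoInMeasure_pi {ι : Type*} [Fintype ι] {E : ι → Type*} [∀ i, PseudoMetricSpace (E i)]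
    {A : ℕ → Ω → ∀ i, E i} {a : ∀ i, E i}
    (h : ∀ i, TendstoInMeasure μ (fun n w => A n w i) atTop (fun _ => a i)) :
    TendstoInMeasure μ A atTop (fun _ => a) := by
  rw [tendstoInMeasure_iff_dist]
  intro e he
  have h1 := tendsto_finsetSum Finset.univ fun i (_ : i ∈ Finset.univ) =>
    tendstoInMeasure_iff_dist.1 (h i) e he
  simp only [Finset.sum_const_zero] at h1
  refine tendsto_of_tendsto_of_tendsto_of_le_of_le tendsto_const_nhds h1 (fun _ => zero_le)
    fun n => ?_
  refine (measure_mono (t := ⋃ i ∈ Finset.univ, {w | e ≤ dist (A n w i) (a i)})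
    fun w hw => ?_).trans (measure_biUnion_finset_le _ _)
  by_contra hcon
  simp only [Finset.mem_univ, Set.iUnion_true, Set.mem_iUnion, Set.mem_ofPred_eq, not_exists,
    not_le] at hcon hw
  exact absurd ((dist_pi_lt_iff he).2 hcon) (not_lt.2 hw)

/-- The continuous mapping theorem for convergence in probability to a constant. -/
lemma tendstoInMeasure_comp_of_continuousAt {E F : Type*} [PseudoMetricSpace E]
    [PseudoMetricSpace F] {A : ℕ → Ω → E} {a : E} {f : E → F} (hf : ContinuousAt f a)
    (h : TendstoInMeasure μ A atTop (fun _ => a)) :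
    TendstoInMeasure μ (fun n w => f (A n w)) atTop (fun _ => f a) := by
  rw [tendstoInMeasure_iff_dist] at h ⊢
  intro e he
  obtain ⟨d, hd, hd'⟩ := Metric.continuousAt_iff.1 hf e he
  refine tendsto_of_tendsto_of_tendsto_of_le_of_le tendsto_const_nhds (h d hd) (fun _ => zero_le)
    fun n => measure_mono fun w hw => ?_
  by_contra hcon
  simp only [Set.mem_ofPred_eq, not_le] at hcon hw
  exact absurd (hd' hcon) (not_lt.2 hw)

lemma tendstoInMeasure_sum_zero {ι : Type*} [Fintype ι] {A : ℕ → Ω → ι → ℝ}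
    (h : ∀ i, TendstoInMeasure μ (fun n w => A n w i) atTop (fun _ => 0)) :
    TendstoInMeasure μ (fun n w => ∑ i, A n w i) atTop (fun _ => 0) := by
  have := tendstoInMeasure_comp_of_continuousAt (f := fun x : ι → ℝ => ∑ i, x i)
    (Continuous.continuousAt (by fun_prop)) (tendstoInMeasure_pi (a := 0) h)
  simpa using this

end ContinuousMapping

/-! ### Tensor powers and moments of random matrix products -/

section Tensor

lemma tensorPower_one (s m : ℕ) : tensorPower s (1 : Matrix (Fin m) (Fin m) ℝ) = 1 := by
  ext r c
  simp only [tensorPower, Matrix.of_apply, Matrix.one_apply]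
  split_ifs with h
  · subst h
    simp
  · obtain ⟨i, hi⟩ := Function.ne_iff.1 h
    exact Finset.prod_eq_zero (Finset.mem_univ i) (by simp [hi])

/-- Distributing a product over sums gives the mixed-product rule. It makes expected tensor powers
multiplicative over independent factors. -/
lemma tensorPower_mul {m : ℕ} (s : ℕ) (A B : Matrix (Fin m) (Fin m) ℝ) :
    tensorPower s (A * B) = tensorPower s A * tensorPower s B := by
  ext r c
  simp only [tensorPower, Matrix.of_apply, Matrix.mul_apply]
  rw [Fintype.prod_sum]
  exact Finset.sum_congr rfl fun x _ => Finset.prod_mul_distrib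

/-- Constant multi-indices are how moments of single entries are read off `Σ_s`. -/
lemma tensorPower_const {m : ℕ} (s : ℕ) (A : Matrix (Fin m) (Fin m) ℝ) (i j : Fin m) :
    tensorPower s A (fun _ => i) (fun _ => j) = A i j ^ s := by
  simp [tensorPower]

/-- The product `A_t A_{t-1} ⋯ A_{t-n+1}` along a path of innovations. -/
noncomputable def coeffProd {p : ℕ} (θ : EuclideanSpace ℝ (Fin (p + 1))) (e : ℤ → ℝ) (t : ℤ) :
    ℕ → Matrix (Fin (p + 1)) (Fin (p + 1)) ℝ
  | 0 => 1
  | n + 1 => coeffProd θ e t n * coeffMatrix θ (e (t - n))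

lemma measurable_coeffMatrix {p : ℕ} (θ : EuclideanSpace ℝ (Fin (p + 1))) (i j : Fin (p + 1)) :
    Measurable fun e : ℝ => coeffMatrix θ e i j := by
  simp only [coeffMatrix, Matrix.of_apply]
  split_ifs <;> fun_prop

lemma measurable_tensorPower_coeffMatrix {p : ℕ} (θ : EuclideanSpace ℝ (Fin (p + 1))) (s : ℕ)
    (r c : Fin s → Fin (p + 1)) :
    Measurable fun e : ℝ => tensorPower s (coeffMatrix θ e) r c := by
  simp only [tensorPower, Matrix.of_apply]
  exact Finset.measurable_prod _ fun i _ => measurable_coeffMatrix θ _ _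

lemma exists_abs_coeffMatrix_le {p : ℕ} (θ : EuclideanSpace ℝ (Fin (p + 1))) :
    ∃ C : ℝ, 0 ≤ C ∧ ∀ e i j, |coeffMatrix θ e i j| ≤ C * (1 + e ^ 2) := by
  refine ⟨1 + ∑ j, |alphaRow θ j|, by positivity, fun e i j => ?_⟩
  have h1 : |alphaRow θ j| ≤ ∑ j, |alphaRow θ j| :=
    Finset.single_le_sum (f := fun j => |alphaRow θ j|) (fun _ _ => abs_nonneg _)
      (Finset.mem_univ j)
  have h0 := abs_nonneg (alphaRow θ j)
  simp only [coeffMatrix, Matrix.of_apply]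
  split_ifs
  · rw [abs_mul, abs_of_nonneg (sq_nonneg e)]
    nlinarith [sq_nonneg e]
  · nlinarith [sq_nonneg e]
  · rw [abs_one]
    nlinarith [sq_nonneg e]
  · rw [abs_zero]
    positivity

variable {Ω : Type*} [mΩ : MeasurableSpace Ω] {μ : Measure Ω}

/-- Entries of the coefficient matrix are `O(1 + e²)`, so a product of four is `O(1 + e⁸)`: this is
where the eighth moment is spent. -/
lemma integrable_tensorPower_coeffMatrix [IsProbabilityMeasure μ] {p : ℕ}
    (θ : EuclideanSpace ℝ (Fin (p + 1)))
    {e : Ω → ℝ} (he : Measurable e) (h8 : Integrable (fun w => |e w| ^ 8) μ)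
    (r c : Fin 4 → Fin (p + 1)) :
    Integrable (fun w => tensorPower 4 (coeffMatrix θ (e w)) r c) μ := by
  obtain ⟨C, hC0, hC⟩ := exists_abs_coeffMatrix_le θ
  refine Integrable.mono' (((integrable_const (1 : ℝ)).add h8).const_mul (16 * C ^ 4))
    ((measurable_tensorPower_coeffMatrix θ 4 r c).comp he).aestronglyMeasurable
    (Eventually.of_forall fun w => ?_)
  simp only [tensorPower, Matrix.of_apply, Real.norm_eq_abs, Finset.abs_prod, Pi.add_apply]
  have h1 : ∏ i : Fin 4, |coeffMatrix θ (e w) (r i) (c i)| ≤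
      ∏ i : Fin 4, C * (1 + e w ^ 2) :=
    Finset.prod_le_prod (fun _ _ => abs_nonneg _) fun i _ => hC _ _ _
  refine h1.trans ?_
  rw [Finset.prod_const, Finset.card_univ, Fintype.card_fin, mul_pow]
  have h2 : |e w| ^ 8 = (e w ^ 2) ^ 4 := by
    rw [← sq_abs (e w)]
    ring
  rw [h2]
  -- The constant 16 comes from `1 + y ≤ 2 max(1, y)`.
  have h3 : ∀ y : ℝ, 0 ≤ y → (1 + y) ^ 4 ≤ 16 * (1 + y ^ 4) := by
    intro y hy
    rcases le_total y 1 with h | h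
    · calc (1 + y) ^ 4 ≤ (1 + 1) ^ 4 := by gcongr
        _ ≤ 16 * (1 + y ^ 4) := by nlinarith [pow_nonneg hy 4]
    · calc (1 + y) ^ 4 ≤ (y + y) ^ 4 := by gcongr
        _ ≤ 16 * (1 + y ^ 4) := by nlinarith [pow_nonneg hy 4]
  calc C ^ 4 * (1 + e w ^ 2) ^ 4 ≤ C ^ 4 * (16 * (1 + (e w ^ 2) ^ 4)) := by
        gcongr
        exact h3 _ (sq_nonneg _)
    _ = _ := by ring

-- Only innovations later than `t - n` enter the first `n` factors, so the next factor, at time `t -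
-- n`, is independent of them.
omit mΩ in
lemma measurable_coeffProd {p : ℕ} (θ : EuclideanSpace ℝ (Fin (p + 1))) {ε : ℤ → Ω → ℝ} (t : ℤ)
    (n : ℕ) (i j : Fin (p + 1)) :
    Measurable[⨆ s ∈ Set.Ioi (t - n), MeasurableSpace.comap (ε s) inferInstance]
      fun w => coeffProd θ (fun s => ε s w) t n i j := by
  induction n generalizing j with
  | zero => exact measurable_const
  | succ n ih =>
    simp only [coeffProd, Matrix.mul_apply]
    refine Finset.measurable_sum _ fun k _ => Measurable.mul ?_ ?_
    · refine (ih k).mono (biSup_mono fun s hs => ?_) le_rfl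
      simp only [Set.mem_Ioi] at hs ⊢
      push_cast
      linarith
    · refine (measurable_coeffMatrix θ k j).comp ?_
      refine (comap_measurable (ε (t - n))).mono ?_ le_rfl
      refine le_biSup (fun s => MeasurableSpace.comap (ε s) inferInstance) ?_
      simp only [Set.mem_Ioi]
      push_cast
      linarith

/-- The expected tensor powers of the random products are the powers of `Σ_s`. -/
lemma integral_tensorPower_coeffProd [IsProbabilityMeasure μ] {p s : ℕ}
    (θ : EuclideanSpace ℝ (Fin (p + 1))) {ε : ℤ → Ω → ℝ} (hε : ∀ t, Measurable (ε t))
    (hind : iIndepFun ε μ)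
    (hident : ∀ s t, IdentDistrib (ε s) (ε t) μ μ)
    (hint : ∀ t r c, Integrable (fun w => tensorPower s (coeffMatrix θ (ε t w)) r c) μ)
    (t₀ t : ℤ) (n : ℕ) (r c : Fin s → Fin (p + 1)) :
    Integrable (fun w => tensorPower s (coeffProd θ (fun u => ε u w) t n) r c) μ ∧
    ∫ w, tensorPower s (coeffProd θ (fun u => ε u w) t n) r c ∂μ =
      (SigmaMat μ s θ (ε t₀) ^ n) r c := by
  have hle : ∀ t, MeasurableSpace.comap (ε t) inferInstance ≤ mΩ := fun t => (hε t).comap_le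
  induction n generalizing c with
  | zero => simp [coeffProd, tensorPower_one]
  | succ n ih =>
    have hmA : ∀ r c, Measurable[⨆ s ∈ ({t - n} : Set ℤ), MeasurableSpace.comap (ε s) inferInstance]
        (fun w => tensorPower s (coeffMatrix θ (ε (t - n) w)) r c) := by
      intro r c
      refine (measurable_tensorPower_coeffMatrix θ s r c).comp ?_
      exact (comap_measurable (ε (t - n))).mono
        (le_biSup (fun s => MeasurableSpace.comap (ε s) inferInstance) (Set.mem_singleton _)) le_rfl
    have hmP : ∀ r c, Measurable[⨆ s ∈ Set.Ioi (t - n), MeasurableSpace.comap (ε s) inferInstance]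
        (fun w => tensorPower s (coeffProd θ (fun u => ε u w) t n) r c) := by
      intro r c
      simp only [tensorPower, Matrix.of_apply]
      exact Finset.measurable_prod _ fun i _ => measurable_coeffProd θ t n _ _
    have hsup : ∀ S : Set ℤ, (⨆ s ∈ S, MeasurableSpace.comap (ε s) inferInstance) ≤ mΩ :=
      fun S => iSup₂_le fun s _ => hle s
    have hI := indep_iSup_of_disjoint hle ((iIndepFun_iff_iIndep _ _ _).1 hind)
      (S := Set.Ioi (t - n)) (T := {t - n}) (by simp)
    have hindep : ∀ x, IndepFun (fun w => tensorPower s (coeffProd θ (fun u => ε u w) t n) r x)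
        (fun w => tensorPower s (coeffMatrix θ (ε (t - n) w)) x c) μ := fun x =>
      (IndepFun_iff_Indep _ _ _).2 (indep_of_indep_of_le_right
        (indep_of_indep_of_le_left hI (hmP r x).comap_le) (hmA x c).comap_le)
    have hmul : ∀ x, Integrable (fun w => tensorPower s (coeffProd θ (fun u => ε u w) t n) r x *
        tensorPower s (coeffMatrix θ (ε (t - n) w)) x c) μ := fun x =>
      (hindep x).integrable_mul (ih x).1 (hint _ x c)
    simp only [coeffProd, tensorPower_mul, Matrix.mul_apply]
    refine ⟨integrable_finsetSum _ fun x _ => hmul x, ?_⟩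
    rw [integral_finsetSum _ fun x _ => hmul x, pow_succ, Matrix.mul_apply]
    refine Finset.sum_congr rfl fun x _ => ?_
    rw [(hindep x).integral_fun_mul_eq_mul_integral
      ((hmP r x).mono (hsup _) le_rfl).aestronglyMeasurable
      ((hmA x c).mono (hsup _) le_rfl).aestronglyMeasurable, (ih x).2]
    congr 1
    simp only [SigmaMat, Matrix.of_apply]
    exact ((hident (t - n) t₀).comp (measurable_tensorPower_coeffMatrix θ s x c)).integral_eq

lemma eLpNorm_four_le {f : Ω → ℝ} {B : ℝ} (hB : 0 ≤ B) (hf : Integrable (fun w => f w ^ 4) μ)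
    (h : ∫ w, f w ^ 4 ∂μ ≤ B ^ 4) : eLpNorm f 4 μ ≤ ENNReal.ofReal B := by
  rw [eLpNorm_eq_lintegral_rpow_enorm_toReal (by norm_num) (by norm_num)]
  have h4 : (4 : ENNReal).toReal = ((4 : ℕ) : ℝ) := by simp
  rw [h4]
  have h1 : ∫⁻ w, ‖f w‖ₑ ^ ((4 : ℕ) : ℝ) ∂μ = ENNReal.ofReal (∫ w, f w ^ 4 ∂μ) := by
    rw [ofReal_integral_eq_lintegral_ofReal hf (Eventually.of_forall fun w => by positivity)]
    refine lintegral_congr fun w => ?_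
    rw [ENNReal.rpow_natCast, ← Real.norm_of_nonneg (show 0 ≤ f w ^ 4 by positivity), norm_pow,
      ENNReal.ofReal_pow (norm_nonneg _), ofReal_norm]
  rw [h1]
  calc ENNReal.ofReal (∫ w, f w ^ 4 ∂μ) ^ (1 / ((4 : ℕ) : ℝ))
      ≤ ENNReal.ofReal (B ^ 4) ^ (1 / ((4 : ℕ) : ℝ)) := by gcongr
    _ = ENNReal.ofReal B := by
        rw [ENNReal.ofReal_pow hB, ← ENNReal.rpow_natCast, ← ENNReal.rpow_mul]
        norm_num

/-- Geometric decay of the products of the random coefficient matrices in `L⁴`. -/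
lemma exists_eLpNorm_coeffProd_le [IsProbabilityMeasure μ] {p : ℕ}
    (θ : EuclideanSpace ℝ (Fin (p + 1))) {ε : ℤ → Ω → ℝ} (hε : ∀ t, Measurable (ε t))
    (hind : iIndepFun ε μ) (hident : ∀ s t, IdentDistrib (ε s) (ε t) μ μ) (t₀ : ℤ)
    (h8 : Integrable (fun w => |ε t₀ w| ^ 8) μ)
    (hSigma : spectralRadius ℂ ((SigmaMat μ 4 θ (ε t₀)).map (fun a : ℝ => (a : ℂ))) < 1) :
    ∃ C r : ℝ, 0 ≤ C ∧ 0 < r ∧ r < 1 ∧ ∀ (t : ℤ) (n : ℕ) (i j : Fin (p + 1)),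
      eLpNorm (fun w => coeffProd θ (fun u => ε u w) t n i j) 4 μ ≤ ENNReal.ofReal (C * r ^ n) := by
  obtain ⟨C, r, hC, hr0, hr1, h⟩ := exists_abs_pow_apply_le _ hSigma
  have hint : ∀ t r c, Integrable (fun w => tensorPower 4 (coeffMatrix θ (ε t w)) r c) μ := by
    intro t r c
    refine integrable_tensorPower_coeffMatrix θ (hε t) ?_ r c
    exact ((hident t t₀).comp (u := fun x => |x| ^ 8) (by fun_prop)).integrable_iff.2 h8
  have hroot : ∀ x : ℝ, 0 ≤ x → (x ^ (1 / 4 : ℝ)) ^ 4 = x := fun x hx => by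
    rw [← Real.rpow_natCast, ← Real.rpow_mul hx]
    norm_num
  -- The bound `C rⁿ` holds for the fourth moment; the `L⁴` norm takes fourth roots of both
  -- constants.
  refine ⟨C ^ (1 / 4 : ℝ), r ^ (1 / 4 : ℝ), by positivity, by positivity,
    Real.rpow_lt_one hr0.le hr1 (by norm_num), fun t n i j => ?_⟩
  obtain ⟨h1, h2⟩ := integral_tensorPower_coeffProd θ hε hind hident hint t₀ t n
    (fun _ => i) (fun _ => j)
  simp only [tensorPower_const] at h1 h2
  refine eLpNorm_four_le (by positivity) h1 ?_
  rw [h2, mul_pow, hroot C hC, ← pow_mul, mul_comm n 4, pow_mul, hroot r hr0.le]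
  exact (le_abs_self _).trans (h n _ _)

end Tensor

/-! ### Shifts of paths and measurability with respect to the past -/

section Paths

/-- The shift of a path by `t`. -/
def pathShift (t : ℤ) (x : ℤ → ℝ) : ℤ → ℝ := fun s => x (s + t)

lemma measurable_pathShift (t : ℤ) : Measurable (pathShift t) :=
  measurable_pi_lambda _ fun s => measurable_pi_apply (s + t)

lemma shift_iterate (k : ℕ) (x : ℤ → ℝ) : shift^[k] x = pathShift k x := by
  induction k generalizing x with
  | zero => ext s; simp [pathShift]
  | succ k ih =>
    rw [Function.iterate_succ_apply, ih]
    ext s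
    simp only [pathShift, shift]
    congr 1
    push_cast
    ring

lemma sigmaSq_pathShift {p : ℕ} (θ : EuclideanSpace ℝ (Fin (p + 1))) (x : ℤ → ℝ) (k t : ℤ) :
    sigmaSq θ (pathShift k x) t = sigmaSq θ x (t + k) := by
  simp only [sigmaSq, pathShift]
  congr 1
  refine Finset.sum_congr rfl fun j _ => ?_
  ring_nf

lemma regressor_pathShift (p : ℕ) (x : ℤ → ℝ) (k t : ℤ) :
    regressor p (pathShift k x) t = regressor p x (t + k) := by
  simp only [regressor, pathShift]
  congr 1
  ext j
  ring_nf

lemma regressor_zero (p : ℕ) (x : ℤ → ℝ) (t : ℤ) : regressor p x t 0 = 1 := by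
  simp [regressor]

lemma regressor_succ (p : ℕ) (x : ℤ → ℝ) (t : ℤ) (j : Fin p) :
    regressor p x t j.succ = x (t - (j : ℕ)) ^ 2 := by
  simp [regressor]

/-- Linearity of the conditional variance in `θ` is what turns the ARCH equation into a linear
regression. -/
lemma sigmaSq_eq_dotProduct {p : ℕ} (θ : EuclideanSpace ℝ (Fin (p + 1))) (x : ℤ → ℝ) (t : ℤ) :
    sigmaSq θ x t = WithLp.ofLp θ ⬝ᵥ regressor p x (t - 1) := by
  simp only [dotProduct, Fin.sum_univ_succ, regressor_zero, regressor_succ, sigmaSq, mul_one]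
  congr 1
  refine Finset.sum_congr rfl fun j _ => ?_
  ring_nf

variable {Ω : Type*}

/-- The information `σ(X_s : s < t)`. -/
abbrev past (X : ℤ → Ω → ℝ) (t : ℤ) : MeasurableSpace Ω :=
  MeasurableSpace.comap (fun w (s : Set.Iio t) => X s w) inferInstance

lemma measurable_past {X : ℤ → Ω → ℝ} {s t : ℤ} (h : s < t) : Measurable[past X t] (X s) :=
  (measurable_pi_apply (⟨s, h⟩ : Set.Iio t)).comp
    (comap_measurable fun w (s : Set.Iio t) => X s w)

lemma past_mono (X : ℤ → Ω → ℝ) : Monotone (past X) := by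
  intro s t hst
  refine Measurable.comap_le ?_
  exact @measurable_pi_lambda _ _ _ (past X t) _ _ fun u =>
    measurable_past (lt_of_lt_of_le u.2 hst)

lemma measurable_past_sigmaSq {p : ℕ} (θ : EuclideanSpace ℝ (Fin (p + 1))) (X : ℤ → Ω → ℝ)
    (t : ℤ) : Measurable[past X t] fun w => sigmaSq θ (fun s => X s w) t := by
  refine measurable_const.add (Finset.measurable_sum _ fun j _ => ?_)
  exact ((measurable_past (by omega)).pow_const 2).const_mul _

lemma measurable_past_regressor (p : ℕ) (X : ℤ → Ω → ℝ) (t : ℤ) (i : Fin (p + 1)) :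
    Measurable[past X (t + 1)] fun w => regressor p (fun s => X s w) t i := by
  refine Fin.cases ?_ (fun j => ?_) i
  · simp only [regressor_zero]
    exact measurable_const
  · simp only [regressor_succ]
    exact (measurable_past (by omega)).pow_const 2

lemma measurable_sigmaSq {p : ℕ} (θ : EuclideanSpace ℝ (Fin (p + 1))) (t : ℤ) :
    Measurable fun x : ℤ → ℝ => sigmaSq θ x t := by
  unfold sigmaSq
  fun_prop

lemma measurable_regressor (p : ℕ) (t : ℤ) (i : Fin (p + 1)) :
    Measurable fun x : ℤ → ℝ => regressor p x t i := by
  refine Fin.cases ?_ (fun j => ?_) i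
  · simp only [regressor_zero]
    exact measurable_const
  · simp only [regressor_succ]
    fun_prop

end Paths

/-! ### Stationarity, the state recursion and the eighth moment -/

namespace IsARCH

variable {Ω : Type*} [mΩ : MeasurableSpace Ω] {μ : Measure Ω} {p : ℕ}
  {θ₀ : EuclideanSpace ℝ (Fin (p + 1))} {ε X : ℤ → Ω → ℝ}

lemma measurable_path (hX : IsARCH μ θ₀ ε X) : Measurable fun w t => X t w :=
  measurable_pi_lambda _ hX.measurable_process

lemma past_le (hX : IsARCH μ θ₀ ε X) (t : ℤ) : past X t ≤ mΩ :=
  Measurable.comap_le (measurable_pi_lambda _ fun s => hX.measurable_process s)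

lemma omega_le_sigmaSq (hX : IsARCH μ θ₀ ε X) (x : ℤ → ℝ) (t : ℤ) : θ₀ 0 ≤ sigmaSq θ₀ x t :=
  le_add_of_nonneg_right
    (Finset.sum_nonneg fun j _ => mul_nonneg (hX.alpha_nonneg j) (sq_nonneg _))

lemma sigmaSq_pos (hX : IsARCH μ θ₀ ε X) (x : ℤ → ℝ) (t : ℤ) : 0 < sigmaSq θ₀ x t :=
  hX.omega_pos.trans_le (hX.omega_le_sigmaSq x t)

lemma ae_sq_eq (hX : IsARCH μ θ₀ ε X) :
    ∀ᵐ w ∂μ, ∀ t, X t w ^ 2 = sigmaSq θ₀ (fun s => X s w) t * ε t w ^ 2 := by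
  refine ae_all_iff.2 fun t => ?_
  filter_upwards [hX.equation t] with w hw
  have h := hX.sigmaSq_pos (fun s => X s w) t
  calc X t w ^ 2 = (√(sigmaSq θ₀ (fun s => X s w) t) * ε t w) ^ 2 := by rw [← hw]
    _ = _ := by rw [mul_pow, Real.sq_sqrt h.le]

lemma measurePreserving_pathShift (hX : IsARCH μ θ₀ ε X) (t : ℤ) :
    MeasurePreserving (pathShift t) (μ.map fun w t => X t w) (μ.map fun w t => X t w) := by
  have hnat : ∀ k : ℕ, MeasurePreserving (pathShift k) (μ.map fun w t => X t w)
      (μ.map fun w t => X t w) := by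
    intro k
    have h := hX.stationary_ergodic.toMeasurePreserving.iterate k
    have h' : shift^[k] = pathShift k := funext (shift_iterate k)
    rwa [h'] at h
  obtain ⟨k, rfl | rfl⟩ := t.eq_nat_or_neg
  · exact hnat k
  · refine ⟨measurable_pathShift _, ?_⟩
    -- For a backward shift, the law is first written as its own image under the forward shift, and
    -- the two shifts cancel.
    conv_lhs => rw [← (hnat k).map_eq]
    rw [Measure.map_map (measurable_pathShift _) (measurable_pathShift _)]
    have : pathShift (-(k : ℤ)) ∘ pathShift (k : ℤ) = id := by
      ext x s
      simp [pathShift]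
    rw [this, Measure.map_id]

/-- Stationarity: functionals of the shifted process are identically distributed. -/
lemma identDistrib_shift (hX : IsARCH μ θ₀ ε X) {E : Type*} [MeasurableSpace E]
    {F : (ℤ → ℝ) → E} (hF : Measurable F) (s t : ℤ) :
    IdentDistrib (fun w => F (pathShift s fun u => X u w)) (fun w => F (pathShift t fun u => X u w))
      μ μ := by
  have h : ∀ t, μ.map (fun w => F (pathShift t fun u => X u w)) =
      (μ.map fun w t => X t w).map F := by
    intro t
    conv_rhs => rw [← (hX.measurePreserving_pathShift t).map_eq]
    rw [Measure.map_map (measurable_pathShift t) hX.measurable_path,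
      Measure.map_map hF ((measurable_pathShift t).comp hX.measurable_path)]
    rfl
  have hm : ∀ t, Measurable fun w => F (pathShift t fun u => X u w) := fun t =>
    hF.comp ((measurable_pathShift t).comp hX.measurable_path)
  exact ⟨(hm s).aemeasurable, (hm t).aemeasurable, by rw [h, h]⟩

/-- The law of large numbers for square integrable functionals of the process. -/
lemma tendstoInMeasure_average [IsProbabilityMeasure μ] (hX : IsARCH μ θ₀ ε X) {F : (ℤ → ℝ) → ℝ}
    (hF : Measurable F) (hF2 : MemLp (fun w => F fun u => X u w) 2 μ) :
    TendstoInMeasure μ (fun (n : ℕ) w => (n : ℝ)⁻¹ *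
      ∑ k ∈ Finset.range n, F (pathShift k fun u => X u w)) atTop
      (fun _ => ∫ w, F (fun u => X u w) ∂μ) := by
  have : IsProbabilityMeasure (μ.map fun w t => X t w) :=
    Measure.isProbabilityMeasure_map hX.measurable_path.aemeasurable
  have hF2' : MemLp F 2 (μ.map fun w t => X t w) :=
    (memLp_map_measure_iff hF.aestronglyMeasurable hX.measurable_path.aemeasurable).2 hF2
  have h := tendstoInMeasure_average_of_ergodic hX.stationary_ergodic hF2'
  rw [integral_map hX.measurable_path.aemeasurable hF.aestronglyMeasurable] at h
  simp_rw [shift_iterate] at h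
  rw [tendstoInMeasure_iff_norm] at h ⊢
  intro e he
  refine (h e he).congr fun n => ?_
  have hm : Measurable fun x => (n : ℝ)⁻¹ * ∑ k ∈ Finset.range n, F (pathShift k x) :=
    (Finset.measurable_sum _ fun (k : ℕ) _ => show Measurable fun x => F (pathShift k x) from
      hF.comp (measurable_pathShift k)).const_mul _
  exact Measure.map_apply hX.measurable_path
    (measurableSet_le measurable_const (hm.sub_const _).norm)

/-- The state vector `z_t = (X_t², …, X_{t-p+1}², σ_t²)`. -/
noncomputable def stateVec (θ₀ : EuclideanSpace ℝ (Fin (p + 1))) (x : ℤ → ℝ) (t : ℤ) :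
    Fin (p + 1) → ℝ :=
  fun i => if i = Fin.last p then sigmaSq θ₀ x t else x (t - (i : ℕ)) ^ 2

lemma stateVec_pathShift (θ₀ : EuclideanSpace ℝ (Fin (p + 1))) (x : ℤ → ℝ) (k t : ℤ) :
    stateVec θ₀ (pathShift k x) t = stateVec θ₀ x (t + k) := by
  ext i
  simp only [stateVec, sigmaSq_pathShift, pathShift]
  ring_nf

lemma measurable_stateVec (θ₀ : EuclideanSpace ℝ (Fin (p + 1))) (t : ℤ) (i : Fin (p + 1)) :
    Measurable fun x => stateVec θ₀ x t i := by
  simp only [stateVec]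
  split_ifs
  · exact measurable_sigmaSq θ₀ t
  · fun_prop

lemma alphaRow_dotProduct_stateVec (θ : EuclideanSpace ℝ (Fin (p + 1))) (x : ℤ → ℝ) (t : ℤ) :
    θ 0 + ∑ c, alphaRow θ c * stateVec θ x (t - 1) c = sigmaSq θ x t := by
  rw [Fin.sum_univ_castSucc]
  simp only [alphaRow, Fin.snoc_castSucc, Fin.snoc_last, zero_mul, add_zero, sigmaSq, stateVec,
    (Fin.castSucc_lt_last _).ne, if_false, Fin.val_castSucc]
  congr 1
  refine Finset.sum_congr rfl fun j _ => ?_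
  ring_nf

/-- The stochastic recursion of the state vector. The inhomogeneous term is proportional to a
column of the coefficient matrix. -/
lemma stateVec_recursion (hX : IsARCH μ θ₀ ε X) {q : Fin p} (hq : (q : ℕ) + 1 = p) {w : Ω}
    (hw : ∀ t, X t w ^ 2 = sigmaSq θ₀ (fun s => X s w) t * ε t w ^ 2) (t : ℤ) (i : Fin (p + 1)) :
    stateVec θ₀ (fun s => X s w) t i =
      θ₀ 0 / θ₀ (Fin.last p) * coeffMatrix θ₀ (ε t w) i q.castSucc +
        ∑ c, coeffMatrix θ₀ (ε t w) i c * stateVec θ₀ (fun s => X s w) (t - 1) c := by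
  have hα := hX.alpha_last_pos.ne'
  have hqs : q.succ = Fin.last p := Fin.ext (by simpa using hq)
  -- The inhomogeneous term is `ω₀ (ε², 0, …, 0, 1)`, while column `q` is `α₀ₚ (ε², 0, …, 0, 1)`.
  -- Since `α₀ₚ > 0`, the former is a multiple of the latter, so matrix products alone control the
  -- whole expansion.
  have hrow : alphaRow θ₀ q.castSucc = θ₀ (Fin.last p) := by
    simp [alphaRow, ← hqs]
  have hσ := alphaRow_dotProduct_stateVec θ₀ (fun s => X s w) t
  have h0l : (0 : Fin (p + 1)) ≠ Fin.last p := by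
    have := hX.one_le_order
    rw [ne_eq, Fin.ext_iff]
    simp
    omega
  by_cases hi0 : i = 0
  · subst hi0
    simp only [coeffMatrix, Matrix.of_apply, if_true, hrow]
    simp only [stateVec, if_neg h0l, Fin.val_zero, Nat.cast_zero, sub_zero]
    rw [hw t, ← hσ]
    have : ∑ c, alphaRow θ₀ c * ε t w ^ 2 * stateVec θ₀ (fun s => X s w) (t - 1) c =
        (∑ c, alphaRow θ₀ c * stateVec θ₀ (fun s => X s w) (t - 1) c) * ε t w ^ 2 := by
      rw [Finset.sum_mul]
      exact Finset.sum_congr rfl fun c _ => by ring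
    simp only [stateVec] at this
    rw [this]
    field_simp
    simp only [stateVec]
    ring
  · by_cases hil : i = Fin.last p
    · subst hil
      simp only [coeffMatrix, Matrix.of_apply, if_neg hi0, if_true, hrow]
      rw [div_mul_cancel₀ _ hα, hσ]
      simp [stateVec]
    · obtain ⟨k, rfl⟩ := Fin.exists_succ_eq.2 hi0
      have hkq : ¬ (((q.castSucc : Fin (p + 1)) : ℕ) + 1 = ((k.succ : Fin (p + 1)) : ℕ)) := by
        intro h
        apply hil
        rw [← hqs]
        exact Fin.ext (by simpa using h.symm)
      simp only [coeffMatrix, Matrix.of_apply, if_neg hi0, if_neg hil, if_neg hkq, mul_zero,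
        zero_add, ite_mul, one_mul, zero_mul]
      rw [Finset.sum_eq_single k.castSucc]
      · simp only [stateVec, if_neg hil, (Fin.castSucc_lt_last k).ne, Fin.val_castSucc, Fin.val_succ,
          if_true, if_false]
        congr 2
        push_cast
        ring
      · intro c _ hc
        rw [if_neg]
        intro h
        apply hc
        exact Fin.ext (by simpa using h)
      · simp

/-- Iterating the recursion `n` times. -/
lemma stateVec_expansion (hX : IsARCH μ θ₀ ε X) {q : Fin p} (hq : (q : ℕ) + 1 = p) {w : Ω}
    (hw : ∀ t, X t w ^ 2 = sigmaSq θ₀ (fun s => X s w) t * ε t w ^ 2) (t : ℤ) (n : ℕ)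
    (i : Fin (p + 1)) :
    stateVec θ₀ (fun s => X s w) t i =
      (∑ k ∈ Finset.range n, θ₀ 0 / θ₀ (Fin.last p) *
        coeffProd θ₀ (fun s => ε s w) t (k + 1) i q.castSucc) +
      ∑ c, coeffProd θ₀ (fun s => ε s w) t n i c * stateVec θ₀ (fun s => X s w) (t - n) c := by
  induction n with
  | zero => simp [coeffProd, Matrix.one_apply]
  | succ n ih =>
    rw [ih, Finset.sum_range_succ, add_assoc]
    congr 1
    have hrec := hX.stateVec_recursion hq hw (t - n)
    calc ∑ c, coeffProd θ₀ (fun s => ε s w) t n i c * stateVec θ₀ (fun s => X s w) (t - n) c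
        = ∑ c, (θ₀ 0 / θ₀ (Fin.last p) * (coeffProd θ₀ (fun s => ε s w) t n i c *
            coeffMatrix θ₀ (ε (t - n) w) c q.castSucc) +
            ∑ d, coeffProd θ₀ (fun s => ε s w) t n i c * coeffMatrix θ₀ (ε (t - n) w) c d *
              stateVec θ₀ (fun s => X s w) (t - n - 1) d) := by
          refine Finset.sum_congr rfl fun c _ => ?_
          rw [hrec c, mul_add, Finset.mul_sum]
          congr 1
          · ring
          · exact Finset.sum_congr rfl fun d _ => by ring
      _ = _ := by
          rw [Finset.sum_add_distrib, ← Finset.mul_sum, Finset.sum_comm]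
          have h1 : t - n - 1 = t - ((n + 1 : ℕ) : ℤ) := by push_cast; ring
          rw [h1]
          simp only [coeffProd, Matrix.mul_apply, Finset.sum_mul]

/-- A fixed functional of the shifted process is tight. -/
lemma tight_shift [IsProbabilityMeasure μ] (hX : IsARCH μ θ₀ ε X) {F : (ℤ → ℝ) → ℝ}
    (hF : Measurable F) (s : ℕ → ℤ) (δ : ENNReal) (hδ : 0 < δ) :
    ∃ K : ℝ, ∀ n, μ {w | K < |F (pathShift (s n) fun u => X u w)|} ≤ δ := by
  have hm : Measurable fun w => F (pathShift 0 fun u => X u w) :=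
    hF.comp ((measurable_pathShift 0).comp hX.measurable_path)
  have hlim : Tendsto (fun K : ℕ => μ {w | (K : ℝ) < |F (pathShift 0 fun u => X u w)|}) atTop
      (𝓝 0) := by
    have h := tendsto_measure_iInter_atTop (μ := μ)
      (s := fun K : ℕ => {w | (K : ℝ) < |F (pathShift 0 fun u => X u w)|})
      (fun K => (measurableSet_lt measurable_const hm.norm).nullMeasurableSet)
      (fun a b hab w (hw : (b : ℝ) < _) =>
        show (a : ℝ) < _ from lt_of_le_of_lt (Nat.cast_le.2 hab) hw) ⟨0, measure_ne_top _ _⟩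
    have h0 : ⋂ K : ℕ, {w | (K : ℝ) < |F (pathShift 0 fun u => X u w)|} = ∅ := by
      ext w
      simp only [Set.mem_iInter, Set.mem_ofPred_eq, Set.mem_empty_iff_false, iff_false, not_forall,
        not_lt]
      exact exists_nat_ge _
    rwa [h0, measure_empty] at h
  obtain ⟨K, hK⟩ := (ENNReal.tendsto_nhds_zero.1 hlim δ hδ).exists
  refine ⟨K, fun n => ?_⟩
  -- All shifts have the same law, so the level found at time 0 serves for every `n`.
  have h := (hX.identDistrib_shift hF (s n) 0).measure_mem_eq (s := {x | (K : ℝ) < |x|})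
    (measurableSet_lt measurable_const measurable_norm)
  exact h.le.trans hK

/-- Existence of the eighth moment. -/
lemma memLp_sq_four [IsProbabilityMeasure μ] (hX : IsARCH μ θ₀ ε X) (t₀ : ℤ)
    (h8 : Integrable (fun w => |ε t₀ w| ^ 8) μ)
    (hSigma : spectralRadius ℂ ((SigmaMat μ 4 θ₀ (ε t₀)).map (fun a : ℝ => (a : ℂ))) < 1) (t : ℤ) :
    MemLp (fun w => X t w ^ 2) 4 μ := by
  obtain ⟨C, r, hC, hr0, hr1, hP⟩ := exists_eLpNorm_coeffProd_le θ₀ hX.measurable_innovation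
    hX.indep hX.identDistrib t₀ h8 hSigma
  have hp := hX.one_le_order
  let q : Fin p := ⟨p - 1, by omega⟩
  have hq : (q : ℕ) + 1 = p := by simp only [q]; omega
  have h0l : (0 : Fin (p + 1)) ≠ Fin.last p := by
    rw [ne_eq, Fin.ext_iff]
    simp
    omega
  set κ := θ₀ 0 / θ₀ (Fin.last p) with hκ
  have hκ0 : 0 ≤ κ := div_nonneg hX.omega_pos.le hX.alpha_last_pos.le
  have hmP : ∀ n i j, Measurable fun w => coeffProd θ₀ (fun s => ε s w) t n i j := fun n i j =>
    (measurable_coeffProd θ₀ t n i j).mono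
      (iSup₂_le fun s _ => (hX.measurable_innovation s).comap_le) le_rfl
  let S : ℕ → Ω → ℝ := fun n w => ∑ k ∈ Finset.range n, κ *
    coeffProd θ₀ (fun s => ε s w) t (k + 1) 0 q.castSucc
  have hmS : ∀ n, Measurable (S n) := fun n =>
    Finset.measurable_sum _ fun k _ => (hmP _ _ _).const_mul _
  have hPzero : ∀ c, TendstoInMeasure μ (fun n w => coeffProd θ₀ (fun s => ε s w) t n 0 c) atTop
      (fun _ => 0) := by
    intro c
    refine tendstoInMeasure_of_tendsto_eLpNorm (p := 4) (by norm_num)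
      (fun n => (hmP n 0 c).aestronglyMeasurable) aestronglyMeasurable_const ?_
    have h1 : Tendsto (fun n : ℕ => ENNReal.ofReal (C * r ^ n)) atTop (𝓝 0) := by
      have h2 := (tendsto_pow_atTop_nhds_zero_of_lt_one hr0.le hr1).const_mul C
      rw [mul_zero] at h2
      simpa using ENNReal.tendsto_ofReal h2
    refine tendsto_of_tendsto_of_tendsto_of_le_of_le tendsto_const_nhds h1 (fun _ => zero_le)
      fun n => ?_
    refine le_trans (le_of_eq ?_) (hP t n 0 c)
    congr 1
    ext w
    simp
  -- The initial state has no known moments, but stationarity makes it tight, which is enough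
  -- against products tending to 0.
  have hR : TendstoInMeasure μ (fun n w => ∑ c, coeffProd θ₀ (fun s => ε s w) t n 0 c *
      stateVec θ₀ (fun s => X s w) (t - n) c) atTop (fun _ => 0) := by
    refine tendstoInMeasure_sum_zero fun c => tendstoInMeasure_mul_of_tight (hPzero c) ?_
    intro δ hδ
    obtain ⟨K, hK⟩ := hX.tight_shift (measurable_stateVec θ₀ 0 c) (fun n : ℕ => t - n) δ hδ
    refine ⟨K, fun n => ?_⟩
    have := hK n
    simpa only [stateVec_pathShift, zero_add] using this
  have hS : TendstoInMeasure μ S atTop (fun w => X t w ^ 2) := by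
    rw [tendstoInMeasure_iff_norm] at hR ⊢
    intro e he
    refine (hR e he).congr fun n => measure_congr ?_
    filter_upwards [hX.ae_sq_eq] with w hw
    have h := hX.stateVec_expansion hq hw t n 0
    simp only [stateVec, if_neg h0l, Fin.val_zero, Nat.cast_zero, sub_zero] at h
    have h2 : S n w - X t w ^ 2 = -(∑ c, coeffProd θ₀ (fun s => ε s w) t n 0 c *
        stateVec θ₀ (fun s => X s w) (t - n) c) := by
      simp only [S, stateVec]
      rw [h]
      ring
    change (e ≤ _) = (e ≤ _)
    rw [h2, norm_neg, sub_zero]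
  -- Minkowski's inequality and a geometric series bound the partial sums in `L⁴` uniformly; the
  -- bound then passes to the limit in probability by Fatou.
  have hbound : ∀ n, eLpNorm (S n) 4 μ ≤ ENNReal.ofReal (κ * C * (1 - r)⁻¹) := by
    intro n
    have h1 : S n = ∑ k ∈ Finset.range n, fun w => κ *
        coeffProd θ₀ (fun s => ε s w) t (k + 1) 0 q.castSucc := by
      ext w
      simp [S]
    rw [h1]
    refine (eLpNorm_sum_le (fun k _ => ((hmP _ _ _).const_mul _).aestronglyMeasurable)
      (by norm_num)).trans ?_
    have h2 : ∀ k ∈ Finset.range n, eLpNorm (fun w => κ *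
        coeffProd θ₀ (fun s => ε s w) t (k + 1) 0 q.castSucc) 4 μ ≤
        ENNReal.ofReal (κ * C * r ^ k) := by
      intro k _
      have h3 := eLpNorm_const_smul_le (c := κ) (p := 4) (μ := μ)
        (f := fun w => coeffProd θ₀ (fun s => ε s w) t (k + 1) 0 q.castSucc)
      refine h3.trans ?_
      rw [Real.enorm_of_nonneg hκ0, mul_assoc, ENNReal.ofReal_mul hκ0]
      gcongr
      refine (hP t (k + 1) 0 q.castSucc).trans (ENNReal.ofReal_le_ofReal ?_)
      gcongr C * ?_
      exact pow_le_pow_of_le_one hr0.le hr1.le (Nat.le_succ k)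
    refine (Finset.sum_le_sum h2).trans ?_
    rw [← ENNReal.ofReal_sum_of_nonneg fun k _ => by positivity, ← Finset.mul_sum]
    refine ENNReal.ofReal_le_ofReal (mul_le_mul_of_nonneg_left ?_ (by positivity))
    have hsum := summable_geometric_of_lt_one hr0.le hr1
    rw [← tsum_geometric_of_lt_one hr0.le hr1]
    exact hsum.sum_le_tsum _ fun k _ => by positivity
  refine ⟨((hX.measurable_process t).pow_const 2).aestronglyMeasurable, ?_⟩
  exact (eLpNorm_le_of_tendstoInMeasure (Eventually.of_forall hbound) hS
    (fun n => (hmS n).aestronglyMeasurable)).trans_lt ENNReal.ofReal_lt_top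

end IsARCH

/-! ### Second moment matrices and integrability -/

section PosDef

variable {Ω : Type*} [MeasurableSpace Ω] {μ : Measure Ω}

lemma dotProduct_mulVec_secondMoment {m : ℕ} {V : Ω → Fin m → ℝ}
    (hV : ∀ i j, Integrable (fun w => V w i * V w j) μ) (a : Fin m → ℝ) :
    Integrable (fun w => (a ⬝ᵥ V w) ^ 2) μ ∧
    a ⬝ᵥ (Matrix.of fun i j => ∫ w, V w i * V w j ∂μ).mulVec a = ∫ w, (a ⬝ᵥ V w) ^ 2 ∂μ := by
  have h : ∀ w, (a ⬝ᵥ V w) ^ 2 = ∑ i, ∑ j, a i * (a j * (V w i * V w j)) := by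
    intro w
    rw [sq, dotProduct, Finset.sum_mul_sum]
    exact Finset.sum_congr rfl fun i _ => Finset.sum_congr rfl fun j _ => by ring
  have hi : ∀ i j, Integrable (fun w => a i * (a j * (V w i * V w j))) μ := fun i j =>
    ((hV i j).const_mul _).const_mul _
  simp_rw [h]
  refine ⟨integrable_finsetSum _ fun i _ => integrable_finsetSum _ fun j _ => hi i j, ?_⟩
  rw [integral_finsetSum _ fun i _ => integrable_finsetSum _ fun j _ => hi i j, dotProduct]
  refine Finset.sum_congr rfl fun i _ => ?_
  rw [integral_finsetSum _ fun j _ => hi i j, Matrix.mulVec, dotProduct, Finset.mul_sum]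
  refine Finset.sum_congr rfl fun j _ => ?_
  rw [integral_const_mul, integral_const_mul, Matrix.of_apply]
  ring

/-- A matrix of second moments is positive definite if no nontrivial linear combination vanishes
almost surely. -/
lemma posDef_secondMoment {m : ℕ} {V : Ω → Fin m → ℝ}
    (hV : ∀ i j, Integrable (fun w => V w i * V w j) μ)
    (hnd : ∀ a : Fin m → ℝ, (∀ᵐ w ∂μ, a ⬝ᵥ V w = 0) → a = 0) :
    (Matrix.of fun i j => ∫ w, V w i * V w j ∂μ).PosDef := by
  refine Matrix.PosDef.of_dotProduct_mulVec_pos ?_ fun a ha => ?_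
  · ext i j
    simp [Matrix.conjTranspose_apply, mul_comm]
  · obtain ⟨h1, h2⟩ := dotProduct_mulVec_secondMoment hV a
    rw [star_trivial, h2]
    refine lt_of_le_of_ne (integral_nonneg fun w => sq_nonneg _) fun h0 => ha (hnd a ?_)
    filter_upwards [(integral_eq_zero_iff_of_nonneg (fun w => sq_nonneg (a ⬝ᵥ V w)) h1).1 h0.symm]
      with w hw
    exact pow_eq_zero_iff two_ne_zero |>.1 hw

lemma _root_.MeasureTheory.MemLp.mul_four {f g : Ω → ℝ} (hf : MemLp f 4 μ) (hg : MemLp g 4 μ) :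
    MemLp (fun w => f w * g w) 2 μ := by
  have : ENNReal.HolderTriple 4 4 2 := ⟨by
    rw [← two_mul, show (4 : ENNReal) = 2 * 2 by norm_num,
      ENNReal.mul_inv (Or.inl two_ne_zero) (Or.inl ENNReal.ofNat_ne_top), ← mul_assoc,
      ENNReal.mul_inv_cancel two_ne_zero ENNReal.ofNat_ne_top, one_mul]⟩
  exact hg.mul' hf

lemma memLp_regressor [IsProbabilityMeasure μ] {X : ℤ → Ω → ℝ} {p : ℕ}
    (h4 : ∀ t, MemLp (fun w => X t w ^ 2) 4 μ) (t : ℤ) (i : Fin (p + 1)) :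
    MemLp (fun w => regressor p (fun s => X s w) t i) 4 μ := by
  refine Fin.cases ?_ (fun j => ?_) i
  · simp only [regressor_zero]
    exact memLp_const 1
  · simp only [regressor_succ]
    exact h4 _

lemma memLp_sigmaSq [IsProbabilityMeasure μ] {X : ℤ → Ω → ℝ} {p : ℕ}
    (θ₀ : EuclideanSpace ℝ (Fin (p + 1)))
    (h4 : ∀ t, MemLp (fun w => X t w ^ 2) 4 μ) (t : ℤ) :
    MemLp (fun w => sigmaSq θ₀ (fun s => X s w) t) 4 μ :=
  (memLp_const (θ₀ 0)).add (memLp_finsetSum _ fun _ _ => (h4 _).const_mul _)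

end PosDef

/-! ### Linear independence of the regressors -/

namespace IsARCH

variable {Ω : Type*} [mΩ : MeasurableSpace Ω] {μ : Measure Ω} {p : ℕ}
  {θ₀ : EuclideanSpace ℝ (Fin (p + 1))} {ε X : ℤ → Ω → ℝ}

lemma indepFun_of_measurable_past (hX : IsARCH μ θ₀ ε X) {E : Type*} [MeasurableSpace E]
    {Y : Ω → E} {t : ℤ} (hY : Measurable[past X t] Y) : IndepFun (ε t) Y μ :=
  (IndepFun_iff_Indep _ _ _).2 (indep_of_indep_of_le_right
    ((IndepFun_iff_Indep _ _ _).1 (hX.indep_past t)) hY.comap_le)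

lemma memLp_innovation_sq [IsProbabilityMeasure μ] (hX : IsARCH μ θ₀ ε X) {t₀ : ℤ}
    (h8 : Integrable (fun w => |ε t₀ w| ^ 8) μ) (t : ℤ) : MemLp (fun w => ε t w ^ 2) 2 μ := by
  have hm := hX.measurable_innovation t
  have h8' : Integrable (fun w => |ε t w| ^ 8) μ :=
    ((hX.identDistrib t t₀).comp (u := fun x => |x| ^ 8) (by fun_prop)).integrable_iff.2 h8
  rw [memLp_two_iff_integrable_sq (hm.pow_const 2).aestronglyMeasurable]
  refine ((integrable_const (1 : ℝ)).add h8').mono'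
    ((hm.pow_const 2).pow_const 2).aestronglyMeasurable (Eventually.of_forall fun w => ?_)
  have h : |ε t w| ^ 8 = ((ε t w ^ 2) ^ 2) ^ 2 := by
    rw [← sq_abs (ε t w)]
    ring
  rw [Real.norm_of_nonneg (sq_nonneg _), Pi.add_apply, h]
  nlinarith [sq_nonneg ((ε t w ^ 2) ^ 2 - 1)]

lemma variance_innovation_sq_pos [IsProbabilityMeasure μ] (hX : IsARCH μ θ₀ ε X) {t₀ : ℤ}
    (h8 : Integrable (fun w => |ε t₀ w| ^ 8) μ)
    (hnd : ¬ ∃ c : ℝ, ∀ᵐ w ∂μ, ε t₀ w ^ 2 = c) (t : ℤ) :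
    0 < variance (fun w => ε t w ^ 2) μ := by
  have hv := ((hX.identDistrib t t₀).comp (u := fun x => x ^ 2) (by fun_prop)).variance_eq
  refine lt_of_le_of_ne (variance_nonneg _ _) fun h0 => hnd ?_
  refine ⟨_, ae_eq_integral_of_variance_eq_zero (hX.memLp_innovation_sq h8 t₀) ?_⟩
  rw [h0]
  exact hv.symm

/-- No nontrivial linear combination of the regressors vanishes almost surely. -/
lemma eq_zero_of_dotProduct_regressor [IsProbabilityMeasure μ] (hX : IsARCH μ θ₀ ε X) {t₀ : ℤ}
    (h8 : Integrable (fun w => |ε t₀ w| ^ 8) μ)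
    (hnd : ¬ ∃ c : ℝ, ∀ᵐ w ∂μ, ε t₀ w ^ 2 = c) (t : ℤ) (a : Fin (p + 1) → ℝ)
    (ha : ∀ᵐ w ∂μ, a ⬝ᵥ regressor p (fun s => X s w) t = 0) : a = 0 := by
  have hdot : ∀ w, a ⬝ᵥ regressor p (fun s => X s w) t =
      a 0 + ∑ j : Fin p, a j.succ * X (t - (j : ℕ)) w ^ 2 := by
    intro w
    simp only [dotProduct, Fin.sum_univ_succ, regressor_zero, regressor_succ, mul_one]
  simp_rw [hdot] at ha
  have hsucc : ∀ j : Fin p, a j.succ = 0 := by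
    by_contra hcon
    push Not at hcon
    -- The least index with a nonzero coefficient is the most recent time `s = t - j`; all remaining
    -- terms lie strictly before `s`.
    obtain ⟨j, hj, hmin⟩ := WellFounded.has_min (wellFounded_lt (α := Fin p))
      {j | a j.succ ≠ 0} hcon
    have hj : a j.succ ≠ 0 := hj
    have hlt : ∀ k, k < j → a k.succ = 0 := fun k hk => by
      by_contra h
      exact hmin k h hk
    set s : ℤ := t - (j : ℕ) with hs
    -- The linear relation, with `X_s² = σ_s² ε_s²`, solved for `ε_s²`.
    let g : Ω → ℝ := fun w => -(a 0 + ∑ k ∈ Finset.univ.filter (j < ·),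
      a k.succ * X (t - (k : ℕ)) w ^ 2) / (a j.succ * sigmaSq θ₀ (fun u => X u w) s)
    have hg : Measurable[past X s] g := by
      refine Measurable.div (Measurable.neg (measurable_const.add
        (Finset.measurable_sum _ fun k hk => ?_))) ((measurable_past_sigmaSq θ₀ X s).const_mul _)
      refine ((measurable_past ?_).pow_const 2).const_mul _
      have hk' : (j : ℕ) < k := (Finset.mem_filter.1 hk).2
      omega
    have hεg : (fun w => ε s w ^ 2) =ᵐ[μ] g := by
      filter_upwards [ha, hX.ae_sq_eq] with w hw hsq
      have hσ := (hX.sigmaSq_pos (fun u => X u w) s).ne'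
      have hsplit : ∑ k : Fin p, a k.succ * X (t - (k : ℕ)) w ^ 2 =
          a j.succ * X s w ^ 2 + ∑ k ∈ Finset.univ.filter (j < ·),
            a k.succ * X (t - (k : ℕ)) w ^ 2 := by
        have hnot : j ∉ Finset.univ.filter (j < ·) := by simp
        rw [hs, ← Finset.sum_insert (f := fun k : Fin p => a k.succ * X (t - (k : ℕ)) w ^ 2) hnot]
        refine (Finset.sum_subset (Finset.subset_univ _) fun k _ hk => ?_).symm
        simp only [Finset.mem_insert, Finset.mem_filter, Finset.mem_univ, true_and, not_or,
          not_lt] at hk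
        rw [hlt k (lt_of_le_of_ne hk.2 hk.1), zero_mul]
      rw [hsplit, hsq s] at hw
      simp only [g]
      rw [eq_div_iff (mul_ne_zero hj hσ)]
      linarith
    -- Being a function of the past, `ε_s²` is independent of itself, so its variance, a covariance
    -- of independent variables, is 0.
    have hind : IndepFun (fun w => ε s w ^ 2) (fun w => ε s w ^ 2) μ :=
      ((hX.indepFun_of_measurable_past hg).comp (φ := fun x => x ^ 2) (ψ := id) (by fun_prop)
        measurable_id).congr (Filter.EventuallyEq.refl _ _) hεg.symm
    have hL := hX.memLp_innovation_sq h8 s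
    have hcov := hind.covariance_eq_zero hL hL
    rw [covariance_self hL.aestronglyMeasurable.aemeasurable] at hcov
    exact (hX.variance_innovation_sq_pos h8 hnd s).ne' hcov
  have h0 : a 0 = 0 := by
    obtain ⟨w, hw⟩ := ha.exists
    simpa [hsucc] using hw
  ext i
  refine Fin.cases h0 hsucc i

end IsARCH

/-! ### Algebra and measurability of least squares -/

section LeastSquares

open Matrix

/-- With an invertible normal matrix, the solution of the normal equations is the unique minimizer
of the sum of squares. -/
lemma sum_sq_residual_lt {n m : ℕ} (A : Matrix (Fin n) (Fin m) ℝ) (y : Fin n → ℝ)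
    (hA : IsUnit (Aᵀ * A).det) {b : Fin m → ℝ} (hb : b ≠ (Aᵀ * A)⁻¹ *ᵥ (Aᵀ *ᵥ y)) :
    ∑ i, (y i - (A *ᵥ ((Aᵀ * A)⁻¹ *ᵥ (Aᵀ *ᵥ y))) i) ^ 2 < ∑ i, (y i - (A *ᵥ b) i) ^ 2 := by
  set c := (Aᵀ * A)⁻¹ *ᵥ (Aᵀ *ᵥ y) with hc
  -- The residual at `c` is orthogonal to the range of `A`; Pythagoras then gives the strict
  -- inequality because `A` is injective.
  have hnormal : Aᵀ *ᵥ (y - A *ᵥ c) = 0 := by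
    rw [mulVec_sub, mulVec_mulVec, hc, mulVec_mulVec, mul_nonsing_inv _ hA, one_mulVec, sub_self]
  have hne : A *ᵥ (b - c) ≠ 0 := by
    intro h0
    have h1 : (Aᵀ * A) *ᵥ (b - c) = 0 := by rw [← mulVec_mulVec, h0, mulVec_zero]
    have h2 : (Aᵀ * A)⁻¹ *ᵥ ((Aᵀ * A) *ᵥ (b - c)) = b - c := by
      rw [mulVec_mulVec, nonsing_inv_mul _ hA, one_mulVec]
    rw [h1, mulVec_zero] at h2
    exact hb (sub_eq_zero.1 h2.symm)
  have horth : ∑ i, (y i - (A *ᵥ c) i) * (A *ᵥ (b - c)) i = 0 := by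
    have h : (y - A *ᵥ c) ⬝ᵥ (A *ᵥ (b - c)) = 0 := by
      rw [dotProduct_mulVec, ← mulVec_transpose, hnormal, zero_dotProduct]
    exact h
  have hpos : 0 < ∑ i, (A *ᵥ (b - c)) i ^ 2 := by
    obtain ⟨i, hi⟩ := Function.ne_iff.1 hne
    exact Finset.sum_pos' (fun _ _ => sq_nonneg _) ⟨i, Finset.mem_univ i, pow_two_pos_of_ne_zero hi⟩
  have hexp : ∑ i, (y i - (A *ᵥ b) i) ^ 2 = ∑ i, (y i - (A *ᵥ c) i) ^ 2 -
      2 * ∑ i, (y i - (A *ᵥ c) i) * (A *ᵥ (b - c)) i + ∑ i, (A *ᵥ (b - c)) i ^ 2 := by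
    rw [Finset.mul_sum, ← Finset.sum_sub_distrib, ← Finset.sum_add_distrib]
    refine Finset.sum_congr rfl fun i _ => ?_
    have : (A *ᵥ b) i = (A *ᵥ c) i + (A *ᵥ (b - c)) i := by
      rw [mulVec_sub, Pi.sub_apply]
      ring
    rw [this]
    ring
  rw [hexp, horth]
  linarith

lemma criterion_eq (p n : ℕ) (x : ℤ → ℝ) (θ : EuclideanSpace ℝ (Fin (p + 1))) :
    criterion p n x θ = ∑ i, (response n x i - (design p n x *ᵥ WithLp.ofLp θ) i) ^ 2 := by
  unfold criterion
  refine Finset.sum_congr rfl fun i _ => ?_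
  rw [dotProduct_comm]
  rfl

lemma criterion_lsEstimator_lt {p n : ℕ} {x : ℤ → ℝ}
    (h : IsUnit ((design p n x)ᵀ * design p n x).det) {θ : EuclideanSpace ℝ (Fin (p + 1))}
    (hθ : θ ≠ lsEstimator p n x) :
    criterion p n x (lsEstimator p n x) < criterion p n x θ := by
  rw [criterion_eq, criterion_eq]
  refine sum_sq_residual_lt _ _ h fun hb => hθ ?_
  rw [lsEstimator, ← hb]

/-- The normalized Gram matrix `n⁻¹ YᵀY`. -/
noncomputable def gram (p n : ℕ) (x : ℤ → ℝ) : Matrix (Fin (p + 1)) (Fin (p + 1)) ℝ :=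
  Matrix.of fun i j => (n : ℝ)⁻¹ * ∑ k ∈ Finset.range n, regressor p x k i * regressor p x k j

/-- The normalized score `n^{-1/2} Yᵀ (X - Y θ)`. -/
noncomputable def score {p : ℕ} (n : ℕ) (θ : EuclideanSpace ℝ (Fin (p + 1))) (x : ℤ → ℝ) :
    Fin (p + 1) → ℝ :=
  fun i => 1 / √n * ∑ k ∈ Finset.range n,
    regressor p x k i * (x (k + 1) ^ 2 - sigmaSq θ x (k + 1))

lemma design_transpose_mul (p : ℕ) {n : ℕ} (hn : 0 < n) (x : ℤ → ℝ) :
    (design p n x)ᵀ * design p n x = (n : ℝ) • gram p n x := by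
  have hn' : (n : ℝ) ≠ 0 := by exact_mod_cast hn.ne'
  ext i j
  simp only [Matrix.mul_apply, Matrix.transpose_apply, design, Matrix.of_apply, Matrix.smul_apply,
    gram, smul_eq_mul]
  rw [mul_inv_cancel_left₀ hn',
    ← Fin.sum_univ_eq_sum_range (fun k => regressor p x (k : ℤ) i * regressor p x (k : ℤ) j)]

lemma isUnit_det_design {p n : ℕ} (hn : 0 < n) {x : ℤ → ℝ} (h : (gram p n x).det ≠ 0) :
    IsUnit ((design p n x)ᵀ * design p n x).det := by
  rw [design_transpose_mul p hn, det_smul]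
  exact (mul_ne_zero (pow_ne_zero _ (by exact_mod_cast hn.ne')) h).isUnit

lemma design_transpose_mulVec_residual {p : ℕ} (θ : EuclideanSpace ℝ (Fin (p + 1))) {n : ℕ}
    (hn : 0 < n) (x : ℤ → ℝ) :
    (design p n x)ᵀ *ᵥ (response n x - design p n x *ᵥ WithLp.ofLp θ) = √n • score n θ x := by
  have hn' : √(n : ℝ) ≠ 0 := (Real.sqrt_pos.2 (by exact_mod_cast hn)).ne'
  ext i
  simp only [mulVec, dotProduct, Matrix.transpose_apply, design, Matrix.of_apply, Pi.sub_apply,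
    Pi.smul_apply, smul_eq_mul, score, response]
  rw [← mul_assoc, mul_one_div_cancel hn', one_mul,
    ← Fin.sum_univ_eq_sum_range (fun k => regressor p x (k : ℤ) i *
      (x ((k : ℤ) + 1) ^ 2 - sigmaSq θ x ((k : ℤ) + 1)))]
  refine Finset.sum_congr rfl fun k _ => ?_
  rw [sigmaSq_eq_dotProduct, add_sub_cancel_right, dotProduct]
  congr 2
  exact Finset.sum_congr rfl fun j _ => mul_comm _ _

/-- The normalized estimation error. -/
lemma sqrt_smul_lsEstimator_sub {p : ℕ} (θ : EuclideanSpace ℝ (Fin (p + 1))) {n : ℕ} (hn : 0 < n)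
    {x : ℤ → ℝ} (h : (gram p n x).det ≠ 0) :
    √n • (WithLp.ofLp (lsEstimator p n x) - WithLp.ofLp θ) = (gram p n x)⁻¹ *ᵥ score n θ x := by
  have hn0 : (0 : ℝ) < n := by exact_mod_cast hn
  have hu := isUnit_det_design hn h
  have h1 : WithLp.ofLp (lsEstimator p n x) - WithLp.ofLp θ =
      ((design p n x)ᵀ * design p n x)⁻¹ *ᵥ
        ((design p n x)ᵀ *ᵥ (response n x - design p n x *ᵥ WithLp.ofLp θ)) := by
    rw [mulVec_sub, mulVec_sub, mulVec_mulVec _ (design p n x)ᵀ, mulVec_mulVec _ _ (_ * _),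
      nonsing_inv_mul _ hu, one_mulVec]
    rfl
  have h2 : ((n : ℝ) • gram p n x)⁻¹ = (n : ℝ)⁻¹ • (gram p n x)⁻¹ := by
    refine inv_eq_left_inv ?_
    rw [smul_mul_smul_comm, inv_mul_cancel₀ hn0.ne', nonsing_inv_mul _ h.isUnit, one_smul]
  rw [h1, design_transpose_mulVec_residual θ hn, design_transpose_mul p hn, h2, mulVec_smul,
    smul_mulVec, smul_smul, smul_smul]
  have h3 : √(n : ℝ) * √n * (n : ℝ)⁻¹ = 1 := by
    rw [Real.mul_self_sqrt hn0.le, mul_inv_cancel₀ hn0.ne']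
  rw [h3, one_smul]

/-- The inverse is the adjugate over the determinant, with value 0 where the latter vanishes, so
singular matrices need no separate treatment. -/
lemma measurable_matrix_inv {α : Type*} [MeasurableSpace α] {m : ℕ}
    {A : α → Matrix (Fin m) (Fin m) ℝ} (hA : ∀ i j, Measurable fun x => A x i j) (i j : Fin m) :
    Measurable fun x => (A x)⁻¹ i j := by
  have hdet : ∀ {B : α → Matrix (Fin m) (Fin m) ℝ}, (∀ i j, Measurable fun x => B x i j) →
      Measurable fun x => (B x).det := by
    intro B hB
    simp only [det_apply]
    exact Finset.measurable_sum _ fun σ _ =>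
      (Finset.measurable_prod _ fun i _ => hB _ _).const_smul _
  simp only [inv_def, Matrix.smul_apply, Ring.inverse_eq_inv', smul_eq_mul, adjugate_apply]
  refine (hdet hA).inv.mul (hdet fun k l => ?_)
  simp only [updateRow_apply]
  split_ifs
  · exact measurable_const
  · exact hA k l

lemma measurable_lsEstimator (p n : ℕ) : Measurable fun x => lsEstimator p n x := by
  have hD : ∀ i j, Measurable fun x : ℤ → ℝ => design p n x i j := fun i j =>
    measurable_regressor p _ j
  refine (WithLp.measurable_toLp 2 _).comp (measurable_pi_lambda _ fun i => ?_)
  simp only [mulVec, dotProduct]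
  refine Finset.measurable_sum _ fun j _ => (measurable_matrix_inv (fun k l => ?_) i j).mul
    (Finset.measurable_sum _ fun k _ => (hD k j).mul ?_)
  · simp only [Matrix.mul_apply, Matrix.transpose_apply]
    exact Finset.measurable_sum _ fun s _ => (hD s k).mul (hD s l)
  · exact (measurable_pi_apply _).pow_const 2

end LeastSquares

lemma pathShift_zero (x : ℤ → ℝ) : pathShift 0 x = x := by
  ext s
  simp [pathShift]

lemma tendstoInMeasure_mul {Ω : Type*} [MeasurableSpace Ω] {μ : Measure Ω} {U V : ℕ → Ω → ℝ}
    {a b : ℝ} (hU : TendstoInMeasure μ U atTop (fun _ => a))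
    (hV : TendstoInMeasure μ V atTop (fun _ => b)) :
    TendstoInMeasure μ (fun n w => U n w * V n w) atTop (fun _ => a * b) := by
  have h : TendstoInMeasure μ (fun n w => ![U n w, V n w]) atTop (fun _ => ![a, b]) :=
    tendstoInMeasure_pi fun i => by
      fin_cases i
      · simpa using hU
      · simpa using hV
  have := tendstoInMeasure_comp_of_continuousAt (f := fun x : Fin 2 → ℝ => x 0 * x 1)
    (Continuous.continuousAt (by fun_prop)) h
  simpa using this

lemma tendstoInMeasure_const_of_tendsto {Ω : Type*} [MeasurableSpace Ω] {μ : Measure Ω}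
    [IsFiniteMeasure μ] {u : ℕ → ℝ} {a : ℝ} (hu : Tendsto u atTop (𝓝 a)) :
    TendstoInMeasure μ (fun n _ => u n) atTop (fun _ => a) :=
  tendstoInMeasure_of_tendsto_ae (fun _ => aestronglyMeasurable_const)
    (Eventually.of_forall fun _ => hu)

/-- Cramer's formula. The argument is an array so that entrywise convergence in probability, made
joint by `tendstoInMeasure_pi`, can be composed with it. -/
lemma continuousAt_matrix_inv_apply {m : ℕ} {U : Matrix (Fin m) (Fin m) ℝ} (hU : U.det ≠ 0)
    (i j : Fin m) :
    ContinuousAt (fun M : Fin m → Fin m → ℝ => (Matrix.of M)⁻¹ i j) fun i j => U i j := by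
  have hid : Continuous fun M : Fin m → Fin m → ℝ => Matrix.of M := continuous_id
  have hadj : Continuous fun M : Fin m → Fin m → ℝ => (Matrix.of M).adjugate i j :=
    hid.matrix_adjugate.matrix_elem i j
  simp only [Matrix.inv_def, Matrix.smul_apply, Ring.inverse_eq_inv', smul_eq_mul]
  exact (hid.matrix_det.continuousAt.inv₀ hU).mul hadj.continuousAt

/-- The linear functional `√v (aᵀ Y₀) σ₁²` of a path. -/
noncomputable def weight {p : ℕ} (v : ℝ) (θ : EuclideanSpace ℝ (Fin (p + 1)))
    (a : Fin (p + 1) → ℝ) (x : ℤ → ℝ) : ℝ :=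
  √v * (a ⬝ᵥ regressor p x 0 * sigmaSq θ x 1)

lemma measurable_weight {p : ℕ} (v : ℝ) (θ : EuclideanSpace ℝ (Fin (p + 1)))
    (a : Fin (p + 1) → ℝ) : Measurable (weight v θ a) :=
  ((Finset.measurable_sum _ fun i _ => (measurable_regressor p 0 i).const_mul _).mul
    (measurable_sigmaSq θ 1)).const_mul _

lemma weight_pathShift {p : ℕ} (v : ℝ) (θ : EuclideanSpace ℝ (Fin (p + 1)))
    (a : Fin (p + 1) → ℝ) (k : ℤ) (x : ℤ → ℝ) :
    weight v θ a (pathShift k x) = √v * (a ⬝ᵥ regressor p x k * sigmaSq θ x (k + 1)) := by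
  rw [weight, regressor_pathShift, sigmaSq_pathShift, zero_add, add_comm 1 k]

/-- The innovation `(ε_{k+1}² - 1) / √v`, expressed through the path of the process. -/
noncomputable def innov {p : ℕ} (v : ℝ) (θ : EuclideanSpace ℝ (Fin (p + 1))) (x : ℤ → ℝ) (k : ℕ) :
    ℝ :=
  (x (k + 1) ^ 2 / sigmaSq θ x (k + 1) - 1) / √v

/-! ### The score as a martingale -/

namespace IsARCH

variable {Ω : Type*} [mΩ : MeasurableSpace Ω] {μ : Measure Ω} {p : ℕ}
  {θ₀ : EuclideanSpace ℝ (Fin (p + 1))} {ε X : ℤ → Ω → ℝ}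

/-- The innovations are written through `X` because `ε` itself need not be measurable for the past
of `X`; `X² / σ²` is, and equals `ε²` almost surely. Stage `k` knows `X` up to time `k`, and `ζ_k`
is revealed at time `k + 1`. -/
lemma isInnovation [IsProbabilityMeasure μ] (hX : IsARCH μ θ₀ ε X) {t : ℤ}
    (h8 : Integrable (fun w => |ε t w| ^ 8) μ)
    (hv : 0 < variance (fun w => ε t w ^ 2) μ) :
    IsInnovation μ (fun k : ℕ => past X (k + 1))
      (fun k w => innov (variance (fun w => ε t w ^ 2) μ) θ₀ (fun s => X s w) k)
      (μ.map fun w => (ε t w ^ 2 - 1) / √(variance (fun w => ε t w ^ 2) μ)) := by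
  set v := variance (fun w => ε t w ^ 2) μ with hvdef
  have hmφ : Measurable fun x : ℝ => (x ^ 2 - 1) / √v := by fun_prop
  have hme := hX.measurable_innovation t
  have hmc : Measurable fun w => (ε t w ^ 2 - 1) / √v := hmφ.comp hme
  have hL := hX.memLp_innovation_sq h8 t
  have hae : ∀ k : ℕ, (fun w => (ε (k + 1) w ^ 2 - 1) / √v) =ᵐ[μ]
      fun w => innov v θ₀ (fun s => X s w) k := by
    intro k
    filter_upwards [hX.ae_sq_eq] with w hw
    rw [innov, hw, mul_div_cancel_left₀ _ (hX.sigmaSq_pos _ _).ne']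
  refine ⟨fun k => hX.past_le _, fun a b hab => past_mono X (by simpa using hab), fun k => ?_,
    fun k => ?_, fun k => ?_, ?_, ?_⟩
  · refine Measurable.div_const (Measurable.sub_const (Measurable.div ?_ ?_) _) _
    · exact (measurable_past (by push_cast; linarith)).pow_const 2
    · exact (measurable_past_sigmaSq θ₀ X _).mono (past_mono X (by push_cast; linarith)) le_rfl
  · rw [past, ← IndepFun_iff_Indep]
    exact ((hX.indep_past (k + 1)).comp hmφ measurable_id).congr (hae k)
      (Filter.EventuallyEq.refl _ _)
  · rw [← Measure.map_congr (hae k)]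
    exact ((hX.identDistrib (k + 1) t).comp hmφ).map_eq
  · rw [integral_map hmc.aemeasurable (by fun_prop), integral_div,
      integral_sub (hL.integrable one_le_two) (integrable_const _), hX.second_moment]
    simp
  · rw [integral_map hmc.aemeasurable (by fun_prop)]
    simp_rw [div_pow, Real.sq_sqrt hv.le]
    rw [integral_div, div_eq_one_iff_eq hv.ne', hvdef,
      variance_eq_integral (hme.pow_const 2).aemeasurable, hX.second_moment]

/-- The residual `X² - σ²` is `σ² (X²/σ² - 1)`; the factor `√v` in the weight cancels the
normalization of the innovation. -/
lemma dotProduct_score (hX : IsARCH μ θ₀ ε X) {v : ℝ} (hv : 0 < v) (a : Fin (p + 1) → ℝ) (n : ℕ)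
    (x : ℤ → ℝ) :
    a ⬝ᵥ score n θ₀ x = 1 / √n * ∑ k ∈ Finset.range n,
      weight v θ₀ a (pathShift k x) * innov v θ₀ x k := by
  have hv' : √v ≠ 0 := (Real.sqrt_pos.2 hv).ne'
  simp only [dotProduct, score]
  simp_rw [mul_left_comm (a _) (1 / √(n : ℝ)), ← Finset.mul_sum (a := 1 / √(n : ℝ)),
    Finset.mul_sum _ _ (a _)]
  rw [Finset.sum_comm]
  congr 1
  refine Finset.sum_congr rfl fun k _ => ?_
  have hσ := (hX.sigmaSq_pos x (k + 1)).ne'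
  rw [weight_pathShift, innov, dotProduct]
  have h : √v * ((∑ i, a i * regressor p x k i) * sigmaSq θ₀ x (k + 1)) *
      ((x (k + 1) ^ 2 / sigmaSq θ₀ x (k + 1) - 1) / √v) =
      (∑ i, a i * regressor p x k i) * (x (k + 1) ^ 2 - sigmaSq θ₀ x (k + 1)) := by
    field_simp
  rw [h, Finset.sum_mul]
  exact Finset.sum_congr rfl fun i _ => by ring

omit mΩ in
lemma measurable_past_weight (θ₀ : EuclideanSpace ℝ (Fin (p + 1))) (X : ℤ → Ω → ℝ) (v : ℝ)
    (a : Fin (p + 1) → ℝ) (k : ℕ) :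
    Measurable[past X (k + 1)] fun w => weight v θ₀ a (pathShift k fun s => X s w) := by
  simp only [weight_pathShift, dotProduct]
  exact ((Finset.measurable_sum _ fun i _ => (measurable_past_regressor p X k i).const_mul _).mul
    (measurable_past_sigmaSq θ₀ X _)).const_mul _

lemma memLp_weight [IsProbabilityMeasure μ] (θ₀ : EuclideanSpace ℝ (Fin (p + 1)))
    (h4 : ∀ t, MemLp (fun w => X t w ^ 2) 4 μ) (v : ℝ) (a : Fin (p + 1) → ℝ) (k : ℤ) :
    MemLp (fun w => weight v θ₀ a (pathShift k fun s => X s w)) 2 μ := by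
  simp only [weight_pathShift, dotProduct]
  exact (MemLp.mul_four (memLp_finsetSum _ fun i _ => (memLp_regressor h4 k i).const_mul _)
    (memLp_sigmaSq θ₀ h4 _)).const_mul _

lemma integral_weight_sq [IsProbabilityMeasure μ] (hX : IsARCH μ θ₀ ε X)
    (h4 : ∀ t, MemLp (fun w => X t w ^ 2) 4 μ) {v : ℝ} (hv : 0 ≤ v) (a : Fin (p + 1) → ℝ)
    (t : ℤ) (k : ℤ) :
    ∫ w, weight v θ₀ a (pathShift k fun s => X s w) ^ 2 ∂μ =
      v * a ⬝ᵥ (matR μ θ₀ X t).mulVec a := by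
  let V : Ω → Fin (p + 1) → ℝ := fun w i =>
    sigmaSq θ₀ (fun s => X s w) t * regressor p (fun s => X s w) (t - 1) i
  have hR : matR μ θ₀ X t = Matrix.of fun i j => ∫ w, V w i * V w j ∂μ := by
    ext i j
    simp only [matR, Matrix.of_apply, V]
    congr 1
    ext w
    ring
  have hV : ∀ i, MemLp (fun w => V w i) 2 μ := fun i =>
    (memLp_sigmaSq θ₀ h4 t).mul_four (memLp_regressor h4 (t - 1) i)
  have h1 := (hX.identDistrib_shift ((measurable_weight v θ₀ a).pow_const 2) k (t - 1)).integral_eq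
  rw [h1, hR, (dotProduct_mulVec_secondMoment (fun i j => (hV i).integrable_mul (hV j)) a).2,
    ← integral_const_mul]
  congr 1
  ext w
  have h2 : a ⬝ᵥ V w = a ⬝ᵥ regressor p (fun s => X s w) (t - 1) *
      sigmaSq θ₀ (fun s => X s w) t := by
    simp only [dotProduct, V, Finset.sum_mul]
    exact Finset.sum_congr rfl fun i _ => by ring
  rw [weight_pathShift, sub_add_cancel, h2, mul_pow, Real.sq_sqrt hv]

lemma tight_score [IsProbabilityMeasure μ] (hX : IsARCH μ θ₀ ε X)
    (h4 : ∀ t, MemLp (fun w => X t w ^ 2) 4 μ) {t : ℤ}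
    (h8 : Integrable (fun w => |ε t w| ^ 8) μ)
    (hv : 0 < variance (fun w => ε t w ^ 2) μ) (i : Fin (p + 1)) (δ : ENNReal) (hδ : 0 < δ) :
    ∃ K : ℝ, ∀ n, μ {w | K < |score n θ₀ (fun s => X s w) i|} ≤ δ := by
  obtain ⟨K, hK⟩ := (hX.isInnovation h8 hv).tight_normalized
    (measurable_past_weight θ₀ X _ (Pi.single i 1)) (fun k => memLp_weight θ₀ h4 _ _ _)
    (fun k => hX.integral_weight_sq h4 hv.le _ t k) δ hδ
  refine ⟨K, fun n => ?_⟩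
  have := hK n
  simp_rw [← hX.dotProduct_score hv] at this
  simpa using this

/-- The central limit theorem for linear functionals of the score. -/
lemma tendsto_integral_exp_score [IsProbabilityMeasure μ] (hX : IsARCH μ θ₀ ε X)
    (h4 : ∀ t, MemLp (fun w => X t w ^ 2) 4 μ) {t : ℤ}
    (h8 : Integrable (fun w => |ε t w| ^ 8) μ)
    (hv : 0 < variance (fun w => ε t w ^ 2) μ) (a : Fin (p + 1) → ℝ) :
    Tendsto (fun n : ℕ => ∫ w, Complex.exp
      ((a ⬝ᵥ score n θ₀ (fun s => X s w) : ℝ) * Complex.I) ∂μ) atTop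
      (𝓝 (Complex.exp (-(variance (fun w => ε t w ^ 2) μ *
        a ⬝ᵥ (matR μ θ₀ X t).mulVec a / 2 : ℝ)))) := by
  have hm := measurable_weight (variance (fun w => ε t w ^ 2) μ) θ₀ a
  -- The frequency `u = 1` suffices, since the vector `a` is arbitrary.
  have h := (hX.isInnovation h8 hv).tendsto_integral_exp
    (measurable_past_weight θ₀ X _ a) (memLp_weight θ₀ h4 _ a _)
    (fun k => hX.identDistrib_shift hm _ _) ?_ 1
  · rw [hX.integral_weight_sq h4 hv.le a t] at h
    simp_rw [hX.dotProduct_score hv]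
    convert h using 4
    congr 1
    ring
  · rintro f hf ⟨C, hC⟩
    have := hX.tendstoInMeasure_average (F := fun x => f (weight _ θ₀ a x)) (hf.comp hm)
      (MemLp.of_bound ((hf.comp hm).comp hX.measurable_path).aestronglyMeasurable C
        (Eventually.of_forall fun w => hC _))
    simpa only [Nat.cast_zero, pathShift_zero] using this

lemma tendstoInMeasure_gram [IsProbabilityMeasure μ] (hX : IsARCH μ θ₀ ε X)
    (h4 : ∀ t, MemLp (fun w => X t w ^ 2) 4 μ) (t : ℤ) (i j : Fin (p + 1)) :
    TendstoInMeasure μ (fun n w => gram p n (fun s => X s w) i j) atTop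
      (fun _ => matU μ p X t i j) := by
  have hm : Measurable fun x => regressor p x 0 i * regressor p x 0 j :=
    (measurable_regressor p 0 i).mul (measurable_regressor p 0 j)
  have h1 := (hX.identDistrib_shift hm (t - 1) 0).integral_eq
  simp only [regressor_pathShift, zero_add] at h1
  have h2 := hX.tendstoInMeasure_average hm ((memLp_regressor h4 0 i).mul_four
    (memLp_regressor h4 0 j))
  simp only [regressor_pathShift, zero_add] at h2
  rw [← h1] at h2
  exact h2

end IsARCH

/-! ### Consistency and asymptotic normality -/

namespace IsARCH

variable {Ω : Type*} [mΩ : MeasurableSpace Ω] {μ : Measure Ω} {p : ℕ}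
  {θ₀ : EuclideanSpace ℝ (Fin (p + 1))} {ε X : ℤ → Ω → ℝ}

lemma posDef_matU [IsProbabilityMeasure μ] (hX : IsARCH μ θ₀ ε X)
    (h4 : ∀ t, MemLp (fun w => X t w ^ 2) 4 μ) {t : ℤ}
    (h8 : Integrable (fun w => |ε t w| ^ 8) μ)
    (hnd : ¬ ∃ c : ℝ, ∀ᵐ w ∂μ, ε t w ^ 2 = c) : (matU μ p X t).PosDef :=
  posDef_secondMoment (V := fun w => regressor p (fun s => X s w) (t - 1))
    (fun i j => ((memLp_regressor h4 (t - 1) i).mul_four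
      (memLp_regressor h4 (t - 1) j)).integrable one_le_two)
    fun a ha => hX.eq_zero_of_dotProduct_regressor h8 hnd (t - 1) a ha

lemma integrable_sigmaSq_sq_mul [IsProbabilityMeasure μ] (θ₀ : EuclideanSpace ℝ (Fin (p + 1)))
    (h4 : ∀ t, MemLp (fun w => X t w ^ 2) 4 μ) (t : ℤ) (i j : Fin (p + 1)) :
    Integrable (fun w => sigmaSq θ₀ (fun s => X s w) t ^ 2 *
      (regressor p (fun s => X s w) (t - 1) i * regressor p (fun s => X s w) (t - 1) j)) μ := by
  have h := ((memLp_sigmaSq θ₀ h4 t).mul_four (memLp_regressor h4 (t - 1) i)).integrable_mul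
    ((memLp_sigmaSq θ₀ h4 t).mul_four (memLp_regressor h4 (t - 1) j))
  refine h.congr (Eventually.of_forall fun w => ?_)
  simp only [Pi.mul_apply]
  ring

lemma posDef_matR [IsProbabilityMeasure μ] (hX : IsARCH μ θ₀ ε X)
    (h4 : ∀ t, MemLp (fun w => X t w ^ 2) 4 μ) {t : ℤ}
    (h8 : Integrable (fun w => |ε t w| ^ 8) μ)
    (hnd : ¬ ∃ c : ℝ, ∀ᵐ w ∂μ, ε t w ^ 2 = c) : (matR μ θ₀ X t).PosDef := by
  have hV : ∀ i, MemLp (fun w => sigmaSq θ₀ (fun s => X s w) t *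
      regressor p (fun s => X s w) (t - 1) i) 2 μ := fun i =>
    (memLp_sigmaSq θ₀ h4 t).mul_four (memLp_regressor h4 (t - 1) i)
  have h := posDef_secondMoment (μ := μ) (V := fun w i => sigmaSq θ₀ (fun s => X s w) t *
    regressor p (fun s => X s w) (t - 1) i) (fun i j => (hV i).integrable_mul (hV j)) ?_
  · convert h using 1
    ext i j
    simp only [matR, Matrix.of_apply]
    congr 1
    ext w
    ring
  · intro a ha
    -- The extra factor `σ_t²` is positive and can be divided out, reducing to the case of `U`.
    refine hX.eq_zero_of_dotProduct_regressor h8 hnd (t - 1) a ?_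
    filter_upwards [ha] with w hw
    have h1 : (a ⬝ᵥ fun i => sigmaSq θ₀ (fun s => X s w) t *
        regressor p (fun s => X s w) (t - 1) i) =
        sigmaSq θ₀ (fun s => X s w) t * a ⬝ᵥ regressor p (fun s => X s w) (t - 1) := by
      simp only [dotProduct, Finset.mul_sum]
      exact Finset.sum_congr rfl fun i _ => by ring
    rw [h1] at hw
    exact (mul_eq_zero.1 hw).resolve_left (hX.sigmaSq_pos _ _).ne'

/-- A singular Gram matrix has determinant at the fixed distance `|det U| > 0` from the limit. -/
lemma tendsto_measure_det_gram_eq_zero [IsProbabilityMeasure μ] (hX : IsARCH μ θ₀ ε X)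
    (h4 : ∀ t, MemLp (fun w => X t w ^ 2) 4 μ) {t : ℤ} (hU : (matU μ p X t).det ≠ 0) :
    Tendsto (fun n => μ {w | (gram p n fun s => X s w).det = 0}) atTop (𝓝 0) := by
  have hid : Continuous fun M : Fin (p + 1) → Fin (p + 1) → ℝ => Matrix.of M := continuous_id
  have h := tendstoInMeasure_comp_of_continuousAt
    (f := fun M : Fin (p + 1) → Fin (p + 1) → ℝ => (Matrix.of M).det)
    hid.matrix_det.continuousAt
    (tendstoInMeasure_pi fun i => tendstoInMeasure_pi (hX.tendstoInMeasure_gram h4 t i))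
  rw [tendstoInMeasure_iff_norm] at h
  refine tendsto_of_tendsto_of_tendsto_of_le_of_le tendsto_const_nhds
    (h _ (abs_pos.2 hU)) (fun _ => zero_le) fun n => measure_mono fun w hw => ?_
  have hw : (gram p n fun s => X s w).det = 0 := hw
  change |(matU μ p X t).det| ≤ ‖(gram p n fun s => X s w).det - (matU μ p X t).det‖
  rw [hw, zero_sub, norm_neg, Real.norm_eq_abs]

lemma tendstoInMeasure_gram_inv [IsProbabilityMeasure μ] (hX : IsARCH μ θ₀ ε X)
    (h4 : ∀ t, MemLp (fun w => X t w ^ 2) 4 μ) {t : ℤ} (hU : (matU μ p X t).det ≠ 0)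
    (i j : Fin (p + 1)) :
    TendstoInMeasure μ (fun n w => (gram p n fun s => X s w)⁻¹ i j) atTop
      (fun _ => (matU μ p X t)⁻¹ i j) :=
  tendstoInMeasure_comp_of_continuousAt (continuousAt_matrix_inv_apply hU i j)
    (tendstoInMeasure_pi fun i => tendstoInMeasure_pi (hX.tendstoInMeasure_gram h4 t i))

/-- The replacement of the normalized Gram matrix by its limit is asymptotically negligible. -/
lemma tendstoInMeasure_gram_inv_sub_mulVec_score [IsProbabilityMeasure μ]
    (hX : IsARCH μ θ₀ ε X) (h4 : ∀ t, MemLp (fun w => X t w ^ 2) 4 μ) {t : ℤ}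
    (h8 : Integrable (fun w => |ε t w| ^ 8) μ)
    (hv : 0 < variance (fun w => ε t w ^ 2) μ) (hU : (matU μ p X t).det ≠ 0) :
    TendstoInMeasure μ (fun n w => WithLp.toLp 2
      (((gram p n fun s => X s w)⁻¹ - (matU μ p X t)⁻¹).mulVec (score n θ₀ fun s => X s w)))
      atTop (fun _ => (0 : EuclideanSpace ℝ (Fin (p + 1)))) := by
  refine tendstoInMeasure_comp_of_continuousAt (a := (0 : Fin (p + 1) → ℝ)) (f := WithLp.toLp 2)
    (PiLp.continuous_toLp 2 _).continuousAt (tendstoInMeasure_pi fun i => ?_)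
  simp only [Matrix.mulVec, dotProduct]
  refine tendstoInMeasure_sum_zero fun j => tendstoInMeasure_mul_of_tight ?_
    (hX.tight_score h4 h8 hv j)
  have h := tendstoInMeasure_comp_of_continuousAt (f := fun x => x - (matU μ p X t)⁻¹ i j)
    (Continuous.continuousAt (by fun_prop)) (hX.tendstoInMeasure_gram_inv h4 hU i j)
  simpa using h

/-- Off the singular event this vector is `θ̂_n - θ₀`. Consistency thus needs only tightness of the
score, not its limit law. -/
lemma tendstoInMeasure_gram_inv_mulVec_score [IsProbabilityMeasure μ]
    (hX : IsARCH μ θ₀ ε X) (h4 : ∀ t, MemLp (fun w => X t w ^ 2) 4 μ) {t : ℤ}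
    (h8 : Integrable (fun w => |ε t w| ^ 8) μ)
    (hv : 0 < variance (fun w => ε t w ^ 2) μ) (hU : (matU μ p X t).det ≠ 0) :
    TendstoInMeasure μ (fun (n : ℕ) w => WithLp.toLp 2
      ((gram p n fun s => X s w)⁻¹.mulVec ((1 / √n) • score n θ₀ fun s => X s w)))
      atTop (fun _ => (0 : EuclideanSpace ℝ (Fin (p + 1)))) := by
  refine tendstoInMeasure_comp_of_continuousAt (a := (0 : Fin (p + 1) → ℝ)) (f := WithLp.toLp 2)
    (PiLp.continuous_toLp 2 _).continuousAt (tendstoInMeasure_pi fun i => ?_)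
  simp only [Matrix.mulVec, dotProduct, Pi.smul_apply, smul_eq_mul]
  refine tendstoInMeasure_sum_zero fun j => ?_
  have hsqrt : Tendsto (fun n : ℕ => 1 / √(n : ℝ)) atTop (𝓝 0) :=
    (Real.tendsto_sqrt_atTop.comp tendsto_natCast_atTop_atTop).const_div_atTop 1
  have h := tendstoInMeasure_mul (hX.tendstoInMeasure_gram_inv h4 hU i j)
    (tendstoInMeasure_mul_of_tight (tendstoInMeasure_const_of_tendsto (μ := μ) hsqrt)
      (hX.tight_score h4 h8 hv j))
  simpa only [mul_zero] using h

/-- Existence, consistency and uniqueness of the conditional least-squares estimator. -/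
lemma tendsto_measure_lsEstimator [IsProbabilityMeasure μ] (hX : IsARCH μ θ₀ ε X)
    (h4 : ∀ t, MemLp (fun w => X t w ^ 2) 4 μ) {t : ℤ}
    (h8 : Integrable (fun w => |ε t w| ^ 8) μ)
    (hv : 0 < variance (fun w => ε t w ^ 2) μ) (hU : (matU μ p X t).det ≠ 0)
    {Θ : Set (EuclideanSpace ℝ (Fin (p + 1)))} (hΘ : Θ ∈ 𝓝 θ₀) :
    Tendsto (fun n : ℕ => μ {w |
        IsUnit ((design p n (fun s => X s w)).transpose * design p n (fun s => X s w)).det ∧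
        lsEstimator p n (fun s => X s w) ∈ Θ ∧
        ∀ θ, θ ≠ lsEstimator p n (fun s => X s w) →
          criterion p n (fun s => X s w) (lsEstimator p n (fun s => X s w)) <
            criterion p n (fun s => X s w) θ}) atTop (𝓝 1) := by
  obtain ⟨e, he, hball⟩ := Metric.mem_nhds_iff.1 hΘ
  have h1 := hX.tendsto_measure_det_gram_eq_zero h4 hU
  have h2 := tendstoInMeasure_iff_norm.1
    (hX.tendstoInMeasure_gram_inv_mulVec_score h4 h8 hv hU) e he
  have h3 := ENNReal.Tendsto.sub (tendsto_const_nhds (x := (1 : ENNReal))) (h1.add h2)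
    (Or.inl ENNReal.one_ne_top)
  simp only [add_zero, tsub_zero] at h3
  refine tendsto_of_tendsto_of_tendsto_of_le_of_le' h3 tendsto_const_nhds ?_
    (Eventually.of_forall fun n => prob_le_one)
  filter_upwards [eventually_gt_atTop 0] with n hn
  rw [tsub_le_iff_right, ← measure_univ (μ := μ)]
  -- The whole space is covered by the good event, the singular event and the event of a large
  -- error. Subadditivity gives the lower bound without measurability of the good event.
  refine le_trans (measure_mono (t := _ ∪ (_ ∪ _)) fun w _ => ?_) ((measure_union_le _ _).trans
    (add_le_add le_rfl (measure_union_le _ _)))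
  by_contra hcon
  simp only [Set.mem_union, Set.mem_ofPred_eq, not_or, not_le, sub_zero] at hcon
  obtain ⟨hgood, hdet, hnorm⟩ := hcon
  refine hgood ⟨isUnit_det_design hn hdet, hball ?_, fun θ hθ =>
    criterion_lsEstimator_lt (isUnit_det_design hn hdet) hθ⟩
  have hn' : √(n : ℝ) ≠ 0 := (Real.sqrt_pos.2 (by exact_mod_cast hn)).ne'
  have h4 : lsEstimator p n (fun s => X s w) - θ₀ = WithLp.toLp 2
      ((gram p n fun s => X s w)⁻¹.mulVec ((1 / √n) • score n θ₀ fun s => X s w)) := by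
    rw [Matrix.mulVec_smul, ← sqrt_smul_lsEstimator_sub θ₀ hn hdet, smul_smul,
      one_div_mul_cancel hn', one_smul]
    rfl
  rw [mem_ball_iff_norm, h4]
  exact hnorm

lemma measurable_score (hX : IsARCH μ θ₀ ε X) (n : ℕ) (i : Fin (p + 1)) :
    Measurable fun w => score n θ₀ (fun s => X s w) i := by
  have h : Measurable fun x : ℤ → ℝ => score n θ₀ x i := by
    simp only [score]
    exact (Finset.measurable_sum _ fun k _ => (measurable_regressor p _ i).mul
      (((measurable_pi_apply _).pow_const 2).sub (measurable_sigmaSq θ₀ _))).const_mul _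
  exact h.comp hX.measurable_path

/-- Asymptotic normality of the linearized estimator. -/
lemma tendstoInDistribution_mulVec_score [IsProbabilityMeasure μ] (hX : IsARCH μ θ₀ ε X)
    (h4 : ∀ t, MemLp (fun w => X t w ^ 2) 4 μ) {t : ℤ}
    (h8 : Integrable (fun w => |ε t w| ^ 8) μ)
    (hv : 0 < variance (fun w => ε t w ^ 2) μ) (hU : (matU μ p X t).PosDef)
    (hR : (matR μ θ₀ X t).PosDef) :
    TendstoInDistribution
      (fun (n : ℕ) w => WithLp.toLp 2
        ((matU μ p X t)⁻¹.mulVec (score n θ₀ fun s => X s w)))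
      atTop (id : EuclideanSpace ℝ (Fin (p + 1)) → EuclideanSpace ℝ (Fin (p + 1)))
      (fun _ => μ)
      (multivariateGaussian 0
        (variance (fun w => ε t w ^ 2) μ •
          ((matU μ p X t)⁻¹ * matR μ θ₀ X t * (matU μ p X t)⁻¹))) := by
  set v := variance (fun w => ε t w ^ 2) μ
  set U := matU μ p X t
  set R := matR μ θ₀ X t
  have hsymm : U⁻¹.transpose = U⁻¹ := by
    have h := hU.inv.1
    rwa [Matrix.IsHermitian, Matrix.conjTranspose_eq_transpose_of_trivial] at h
  have hS : (v • (U⁻¹ * R * U⁻¹)).PosSemidef := by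
    have h := hR.posSemidef.conjTranspose_mul_mul_same U⁻¹
    rw [Matrix.conjTranspose_eq_transpose_of_trivial, hsymm] at h
    exact h.smul hv.le
  have hmT : ∀ n : ℕ, Measurable fun w => WithLp.toLp 2
      (U⁻¹.mulVec (score n θ₀ fun s => X s w)) := by
    intro n
    refine (WithLp.measurable_toLp 2 _).comp (measurable_pi_lambda _ fun i => ?_)
    simp only [Matrix.mulVec, dotProduct]
    exact Finset.measurable_sum _ fun j _ => (hX.measurable_score n j).const_mul _
  refine ⟨fun n => (hmT n).aemeasurable, aemeasurable_id, ?_⟩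
  refine ProbabilityMeasure.tendsto_of_tendsto_charFun (E := EuclideanSpace ℝ (Fin (p + 1)))
    fun l => ?_
  change Tendsto (fun n : ℕ => charFun (μ.map fun w => (WithLp.toLp 2
    (U⁻¹.mulVec (score n θ₀ fun s => X s w)) : EuclideanSpace ℝ (Fin (p + 1)))) l) atTop
    (𝓝 (charFun ((multivariateGaussian 0 (v • (U⁻¹ * R * U⁻¹))).map id) l))
  rw [Measure.map_id, charFun_multivariateGaussian hS]
  -- By symmetry of `U⁻¹`, the functional `l` of `U⁻¹ · score` is the functional `U⁻¹ l` of the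
  -- score, whence the sandwich covariance.
  have h := hX.tendsto_integral_exp_score h4 h8 hv (Matrix.vecMul (WithLp.ofLp l) U⁻¹)
  have hlim : Complex.exp (inner ℝ l (0 : EuclideanSpace ℝ (Fin (p + 1))) * Complex.I -
      (WithLp.ofLp l ⬝ᵥ (v • (U⁻¹ * R * U⁻¹)).mulVec (WithLp.ofLp l) : ℝ) / 2) =
      Complex.exp (-(v * Matrix.vecMul (WithLp.ofLp l) U⁻¹ ⬝ᵥ
        R.mulVec (Matrix.vecMul (WithLp.ofLp l) U⁻¹) / 2 : ℝ)) := by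
    have h1 : Matrix.vecMul (WithLp.ofLp l) U⁻¹ ⬝ᵥ R.mulVec (Matrix.vecMul (WithLp.ofLp l) U⁻¹) =
        WithLp.ofLp l ⬝ᵥ (U⁻¹ * R * U⁻¹).mulVec (WithLp.ofLp l) := by
      rw [← Matrix.dotProduct_mulVec, ← Matrix.mulVec_transpose, hsymm, Matrix.mulVec_mulVec,
        Matrix.mulVec_mulVec, Matrix.mul_assoc]
    rw [h1, Matrix.smul_mulVec, dotProduct_smul, inner_zero_right]
    push_cast
    simp
  rw [hlim]
  refine h.congr fun n => ?_
  rw [charFun_apply, integral_map (hmT n).aemeasurable (by fun_prop)]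
  congr 1
  ext w
  rw [EuclideanSpace.inner_eq_star_dotProduct, star_trivial, ← Matrix.dotProduct_mulVec]

/-- Asymptotic normality of the conditional least-squares estimator. -/
lemma tendstoInDistribution_lsEstimator [IsProbabilityMeasure μ] (hX : IsARCH μ θ₀ ε X)
    (h4 : ∀ t, MemLp (fun w => X t w ^ 2) 4 μ) {t : ℤ}
    (h8 : Integrable (fun w => |ε t w| ^ 8) μ)
    (hv : 0 < variance (fun w => ε t w ^ 2) μ) (hU : (matU μ p X t).PosDef)
    (hR : (matR μ θ₀ X t).PosDef) :
    TendstoInDistribution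
      (fun (n : ℕ) w => √n • (lsEstimator p n (fun s => X s w) - θ₀))
      atTop (id : EuclideanSpace ℝ (Fin (p + 1)) → EuclideanSpace ℝ (Fin (p + 1)))
      (fun _ => μ)
      (multivariateGaussian 0
        (variance (fun w => ε t w ^ 2) μ •
          ((matU μ p X t)⁻¹ * matR μ θ₀ X t * (matU μ p X t)⁻¹))) := by
  refine tendstoInDistribution_of_tendstoInMeasure_sub _ _
    (hX.tendstoInDistribution_mulVec_score h4 h8 hv hU hR) ?_ fun n =>
    ((((measurable_lsEstimator p n).comp hX.measurable_path).sub_const θ₀).const_smul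
      (√(n : ℝ))).aemeasurable
  have hdetU := hU.det_pos.ne'
  rw [tendstoInMeasure_iff_norm]
  intro e he
  have h1 := hX.tendsto_measure_det_gram_eq_zero h4 hdetU
  have h2 := tendstoInMeasure_iff_norm.1
    (hX.tendstoInMeasure_gram_inv_sub_mulVec_score h4 h8 hv hdetU) e he
  have h3 := h1.add h2
  rw [add_zero] at h3
  refine tendsto_of_tendsto_of_tendsto_of_le_of_le' tendsto_const_nhds h3
    (Eventually.of_forall fun _ => zero_le) ?_
  filter_upwards [eventually_gt_atTop 0] with n hn
  refine (measure_mono fun w hw => ?_).trans (measure_union_le _ _)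
  -- On the singular event nothing is claimed about the estimator; its probability tends to 0.
  by_cases hdet : (gram p n fun s => X s w).det = 0
  · exact Or.inl hdet
  · refine Or.inr ?_
    have h4 : √n • (lsEstimator p n (fun s => X s w) - θ₀) -
        WithLp.toLp 2 ((matU μ p X t)⁻¹.mulVec (score n θ₀ fun s => X s w)) =
        WithLp.toLp 2 (((gram p n fun s => X s w)⁻¹ - (matU μ p X t)⁻¹).mulVec
          (score n θ₀ fun s => X s w)) := by
      rw [Matrix.sub_mulVec, ← sqrt_smul_lsEstimator_sub θ₀ hn hdet]
      rfl
    have hw : e ≤ ‖√n • (lsEstimator p n (fun s => X s w) - θ₀) -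
        WithLp.toLp 2 ((matU μ p X t)⁻¹.mulVec (score n θ₀ fun s => X s w)) - 0‖ := hw
    rw [h4] at hw
    exact hw

end IsARCH

end ARCH

theorem lemma1 {Ω : Type*} [MeasurableSpace Ω] (μ : Measure Ω) [IsProbabilityMeasure μ]
    {p : ℕ} (θ₀ : EuclideanSpace ℝ (Fin (p + 1))) (ε X : ℤ → Ω → ℝ)
    (hX : ARCH.IsARCH μ θ₀ ε X) (t : ℤ)
    (hnondeg : ¬ ∃ c : ℝ, ∀ᵐ w ∂μ, ε t w ^ 2 = c)
    (h8 : Integrable (fun w => |ε t w| ^ 8) μ)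
    (hSigma : spectralRadius ℂ ((ARCH.SigmaMat μ 4 θ₀ (ε t)).map (fun a : ℝ => (a : ℂ))) < 1) :
    (∀ i j, Integrable (fun w => ARCH.regressor p (fun s => X s w) (t - 1) i *
        ARCH.regressor p (fun s => X s w) (t - 1) j) μ) ∧
    (∀ i j, Integrable (fun w => ARCH.sigmaSq θ₀ (fun s => X s w) t ^ 2 *
        (ARCH.regressor p (fun s => X s w) (t - 1) i *
          ARCH.regressor p (fun s => X s w) (t - 1) j)) μ) ∧
    (ARCH.matU μ p X t).PosDef ∧
    (ARCH.matR μ θ₀ X t).PosDef ∧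
    (∀ Θ ∈ 𝓝 θ₀, Tendsto (fun n : ℕ => μ {w |
        IsUnit ((ARCH.design p n (fun s => X s w)).transpose *
          ARCH.design p n (fun s => X s w)).det ∧
        ARCH.lsEstimator p n (fun s => X s w) ∈ Θ ∧
        ∀ θ, θ ≠ ARCH.lsEstimator p n (fun s => X s w) →
          ARCH.criterion p n (fun s => X s w) (ARCH.lsEstimator p n (fun s => X s w)) <
            ARCH.criterion p n (fun s => X s w) θ}) atTop (𝓝 1)) ∧
    TendstoInDistribution
      (fun (n : ℕ) w => Real.sqrt n • (ARCH.lsEstimator p n (fun s => X s w) - θ₀))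
      atTop (id : EuclideanSpace ℝ (Fin (p + 1)) → EuclideanSpace ℝ (Fin (p + 1)))
      (fun _ => μ)
      (multivariateGaussian 0
        (variance (fun w => ε t w ^ 2) μ •
          ((ARCH.matU μ p X t)⁻¹ * ARCH.matR μ θ₀ X t * (ARCH.matU μ p X t)⁻¹))) := by
  have h4 := hX.memLp_sq_four t h8 hSigma
  have hv := hX.variance_innovation_sq_pos h8 hnondeg t
  have hU := hX.posDef_matU h4 h8 hnondeg
  have hR := hX.posDef_matR h4 h8 hnondeg
  exact ⟨fun i j => ((ARCH.memLp_regressor h4 (t - 1) i).mul_four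
      (ARCH.memLp_regressor h4 (t - 1) j)).integrable one_le_two,
    ARCH.IsARCH.integrable_sigmaSq_sq_mul θ₀ h4 t, hU, hR,
    fun _ hΘ => hX.tendsto_measure_lsEstimator h4 h8 hv hU.det_pos.ne' hΘ,
    hX.tendstoInDistribution_lsEstimator h4 h8 hv hU hR⟩
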